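/- For a first-order theory $T$, a set $\Psi$ of parameter-free formulas $\psi(x;\bar y)$ (with $x$ a single variable and $\bar y$ a finite tuple of variables whose length may depend on $\psi$) is called directed if, in every model $M \models T$, any two sets of the form $\psi(M;\bar a)=\{b\in M : M\models\psi(b;\bar a)\}$, with $\psi\in\Psi$ and $\bar a$ a tuple from $M$, are either disjoint or comparable under inclusion. The theory $T$ is VC-minimal if there is a directed $\Psi$ such that, in every model $M\models T$, every subset of $M$ that is definable with parameters from $M$ is a (finite) boolean combination of sets $\psi(M;\bar a)$ with $\psi\in\Psi$ and $\bar a$ a tuple from $M$. For an abelian group $A$ let $\mathrm{Th}(A)$ be its complete first-order theory in the pure group language $\{+\}$. Let $A$ and $B$ be abelian groups. (a) If $\mathrm{Th}(A\oplus B)$ is VC-minimal, then $\mathrm{Th}(A)$ is VC-minimal. (b) If $B$ is finite, then $\mathrm{Th}(A)$ is VC-minimal if and only if $\mathrm{Th}(A\oplus B)$ is VC-minimal. -/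

import Mathlib

universe u v w

/-- A family `S` of subsets of `X` is directed if any two members are comparable under inclusion
or disjoint. -/
def DirectedFamily {X : Type u} (S : Set (Set X)) : Prop :=
  ∀ A ∈ S, ∀ B ∈ S, A ⊆ B ∨ B ⊆ A ∨ A ∩ B = ∅

/-- Parameter-free formulas `ψ(x; y₁, …, yₙ)` with one distinguished object variable `x` (the left
summand) and a finite tuple of parameter variables whose length `n` may vary. -/
def PartitionedFormula (L : FirstOrder.Language.{u, v}) : Type (max u v) :=
  Σ n : ℕ, L.Formula (Unit ⊕ Fin n)

/-- The subset `ψ(M; a) = {b | M ⊨ ψ(b; a)}` of `M`. -/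
def PartitionedFormula.instanceSet {L : FirstOrder.Language.{u, v}} (ψ : PartitionedFormula L)
    {M : Type w} [L.Structure M] (a : Fin ψ.1 → M) : Set M :=
  {b | ψ.2.Realize (Sum.elim (fun _ => b) a)}

/-- All the sets `ψ(M; a)` with `ψ ∈ Ψ` and `a` a tuple from `M`. -/
def instanceFamily {L : FirstOrder.Language.{u, v}} (Ψ : Set (PartitionedFormula L))
    (M : Type w) [L.Structure M] : Set (Set M) :=
  {s | ∃ ψ ∈ Ψ, ∃ a : Fin ψ.1 → M, s = ψ.instanceSet a}

/-- `Ψ` is directed for `T` if its instances form a directed family in every model of `T`. -/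
def DirectedFor {L : FirstOrder.Language.{u, v}} (T : L.Theory) (Ψ : Set (PartitionedFormula L)) : Prop :=
  ∀ M : FirstOrder.Language.Theory.ModelType.{u, v, max u v w} T, DirectedFamily (instanceFamily Ψ M)

/-- `T` is VC-minimal: some directed set `Ψ` of parameter-free formulas is such that, in every
model `M` of `T`, every subset of `M` definable with parameters from `M` is a (finite) boolean
combination of instances of formulas of `Ψ` with parameters from `M`. The models range over a
universe `Type (max u v w)`, with `w` arbitrary. -/
def VCMinimal {L : FirstOrder.Language.{u, v}} (T : L.Theory) : Prop :=
  ∃ Ψ : Set (PartitionedFormula L), DirectedFor.{u, v, w} T Ψ ∧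
    ∀ (M : FirstOrder.Language.Theory.ModelType.{u, v, max u v w} T) (s : Set M),
      Set.Definable₁ (Set.univ : Set M) L s →
        s ∈ BooleanSubalgebra.closure (instanceFamily Ψ M)

/-- The only symbol of the pure language of (additive) groups: the binary function symbol `+`. -/
inductive PureGroupFunc : ℕ → Type
  | add : PureGroupFunc 2

/-- The pure group language `{+}`. -/
def pureGroupLanguage : FirstOrder.Language.{0, 0} :=
  ⟨PureGroupFunc, fun _ => Empty⟩

/-- `(M; +)` as a structure in the pure group language. -/
instance pureGroupStructure (M : Type u) [Add M] : pureGroupLanguage.Structure M where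
  funMap := fun f => match f with
    | PureGroupFunc.add => fun v => v 0 + v 1
  RelMap := fun r => nomatch r

/-- `Th(A; +)`, the complete theory of `A` in the pure group language. -/
def groupTheory (A : Type u) [AddCommGroup A] : pureGroupLanguage.Theory :=
  pureGroupLanguage.completeTheory A

/-! VC-minimality of `Th(A)` is equivalent to an index condition on positive primitive (pp)
subgroups, `BoundedPP`: for each pp subgroup `φ(A)` there is an `N` such that every pp subgroup
`ψ(A)` satisfies `[ψ : φ ∩ ψ] < ∞` or `[φ : φ ∩ ψ] ≤ N`. Since `φ(A × B) = φ(A) × φ(B)`, relative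
indices multiply, and both claims become statements about products of indices. `relIndex` takes the
value 0 for an infinite index.

Necessity: by an ultraproduct argument (`exists_card_bound`) the cosets of `φ` need at most `k`
directed instances each. If `[ψ : φ ∩ ψ]` is infinite, the cosets of `φ` and `ψ` form a grid with
infinitely many rows, and directedness permits at most `k` columns
(`DirectedFamily.card_le_of_grid`).

Sufficiency: the condition yields a chain of pp subgroups containing a finite index subgroup of each
pp subgroup (`exists_chain_of_relIndex_bounded`). Cosets of a chain are directed, and they generate
all definable sets by pp elimination of quantifiers (`definable_mem_closure`), which rests on
Neumann's lemma on coverings by cosets. -/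

/-! ### Boolean combinations and directed families of sets -/

/-- `s` is a union of classes of the relation "belonging to the same members of `t`". -/
def SeparatedBy {X : Type u} (t : Set (Set X)) (s : Set X) : Prop :=
  ∀ x y, (∀ T ∈ t, x ∈ T ↔ y ∈ T) → x ∈ s → y ∈ s

namespace SeparatedBy

variable {X : Type u} {t t' : Set (Set X)} {s s' : Set X}

theorem mono (h : SeparatedBy t s) (ht : t ⊆ t') : SeparatedBy t' s :=
  fun x y hxy hx => h x y (fun T hT => hxy T (ht hT)) hx

theorem compl (h : SeparatedBy t s) : SeparatedBy t sᶜ :=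
  fun x y hxy hx hy => hx (h y x (fun T hT => (hxy T hT).symm) hy)

theorem union (h : SeparatedBy t s) (h' : SeparatedBy t s') : SeparatedBy t (s ∪ s') :=
  fun x y hxy hx => hx.imp (h x y hxy) (h' x y hxy)

theorem of_mem (h : s ∈ t) : SeparatedBy t s := fun _ _ hxy hx => (hxy s h).1 hx

end SeparatedBy

theorem exists_separatedBy_of_mem_closure {X : Type u} {F : Set (Set X)} {s : Set X}
    (hs : s ∈ BooleanSubalgebra.closure F) :
    ∃ t : Finset (Set X), ↑t ⊆ F ∧ SeparatedBy (t : Set (Set X)) s := by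
  classical
  induction hs using BooleanSubalgebra.closure_bot_sup_induction with
  | mem x hx => exact ⟨{x}, by simpa using hx, .of_mem (by simp)⟩
  | bot => exact ⟨∅, by simp, fun _ _ _ h => h⟩
  | sup x hx y hy h1 h2 =>
    obtain ⟨t1, h1, h1'⟩ := h1
    obtain ⟨t2, h2, h2'⟩ := h2
    exact ⟨t1 ∪ t2, by simp [h1, h2], (h1'.mono (by simp)).union (h2'.mono (by simp))⟩
  | compl x hx h =>
    obtain ⟨t, h, h'⟩ := h
    exact ⟨t, h, h'.compl⟩

/-- A finite `t` has finitely many atoms, and `s` is the union of the atoms it contains. -/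
theorem mem_closure_of_separatedBy {X : Type u} {F : Set (Set X)} {s : Set X}
    {t : Set (Set X)} (hfin : t.Finite) (ht : t ⊆ BooleanSubalgebra.closure F)
    (hs : SeparatedBy t s) : s ∈ BooleanSubalgebra.closure F := by
  classical
  have := hfin.to_subtype
  let atom : Set t → Set X := fun p => ⨅ T : t, if T ∈ p then (T : Set X) else (T : Set X)ᶜ
  have hatom : ∀ p x, x ∈ atom p ↔ ∀ T : t, x ∈ (T : Set X) ↔ T ∈ p := by
    intro p x
    simp only [atom, Set.iInf_eq_iInter, Set.mem_iInter]
    refine forall_congr' fun T => ?_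
    split_ifs with h <;> simp [h]
  have : s = ⨆ p : {p : Set t // atom p ⊆ s}, atom p := by
    ext x
    simp only [Set.iSup_eq_iUnion, Set.mem_iUnion, Subtype.exists]
    refine ⟨fun hx => ⟨{T | x ∈ (T : Set X)}, fun y hy => ?_, (hatom _ _).2 fun T => Iff.rfl⟩,
      fun ⟨p, hp, hx⟩ => hp hx⟩
    exact hs x y (fun T hT => ((hatom _ _).1 hy ⟨T, hT⟩).symm) hx
  rw [this]
  refine BooleanSubalgebra.iSup_mem fun p => BooleanSubalgebra.iInf_mem fun T => ?_
  split_ifs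
  · exact ht T.2
  · exact BooleanSubalgebra.compl_mem (ht T.2)

/-- A member of a directed family splits at most one of the classes determined by other members. -/
theorem DirectedFamily.mem_of_split {X : Type u} {F : Set (Set X)} (hF : DirectedFamily F)
    {t : Set (Set X)} (ht : t ⊆ F) {S : Set X} (hS : S ∈ F) {x y x' : X}
    (hxy : ∀ T ∈ t, x ∈ T ↔ y ∈ T) (hx : x ∈ S) (hy : y ∉ S) (hx' : x' ∈ S) {T : Set X} (hT : T ∈ t)
    (hxT : x ∈ T) : x' ∈ T := by
  rcases hF S hS T (ht hT) with h | h | h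
  · exact h hx'
  · exact absurd (h ((hxy T hT).1 hxT)) hy
  · exact absurd (h ▸ ⟨hx, hxT⟩ : x ∈ (∅ : Set X)) (Set.notMem_empty x)

/-- By pigeonhole, two rows `i ≠ i'` look the same to the finitely many sets `T` separating the
columns. In each column, a set from the at most `k` describing `D i` must split `x i j` from `x i'
j`, hence split a `T`-class. Different columns lie in different `T`-classes and one directed set
splits at most one class, so `k` bounds the number of columns. -/
theorem DirectedFamily.card_le_of_grid {X : Type u} {F : Set (Set X)} (hF : DirectedFamily F)
    {ι κ : Type*} [Infinite ι] [Fintype κ] (x : ι → κ → X) (D : ι → Set X) (E : κ → Set X) (k : ℕ)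
    (hD : ∀ i, ∃ t : Finset (Set X), ↑t ⊆ F ∧ t.card ≤ k ∧ SeparatedBy (t : Set (Set X)) (D i))
    (hE : ∀ j, ∃ t : Finset (Set X), ↑t ⊆ F ∧ SeparatedBy (t : Set (Set X)) (E j))
    (hxD : ∀ i j, x i j ∈ D i) (hxE : ∀ i j, x i j ∈ E j)
    (hD' : ∀ i i' j, x i j ∈ D i' → i = i') (hE' : ∀ i j j', x i j ∈ E j' → j = j') :
    Fintype.card κ ≤ k := by
  classical
  choose t htF htE using hE
  let T : Finset (Set X) := Finset.univ.biUnion t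
  have hTF : (T : Set (Set X)) ⊆ F := by
    intro S hS
    obtain ⟨j, -, hj⟩ := Finset.mem_biUnion.1 (Finset.mem_coe.1 hS)
    exact htF j hj
  have hTE : ∀ j, SeparatedBy (T : Set (Set X)) (E j) := fun j =>
    (htE j).mono fun S hS => Finset.mem_biUnion.2 ⟨j, Finset.mem_univ j, hS⟩
  obtain ⟨i, i', hne, hii⟩ := Finite.exists_ne_map_eq_of_infinite
    (fun i : ι => fun (j : κ) (S : T) => x i j ∈ (S : Set X))
  have hsame : ∀ j, ∀ S ∈ (T : Set (Set X)), x i j ∈ S ↔ x i' j ∈ S := fun j S hS =>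
    iff_of_eq (congrFun (congrFun hii j) ⟨S, hS⟩)
  obtain ⟨r, hrF, hrk, hr⟩ := hD i
  have hsplit : ∀ j, ∃ S ∈ r, ¬ (x i j ∈ S ↔ x i' j ∈ S) := by
    intro j
    by_contra! h
    exact hne (hD' i' i j (hr _ _ h (hxD i j))).symm
  choose S hSr hS using hsplit
  have hinj : Function.Injective S := by
    intro j j' hjj
    have key : ∀ a a', (∀ T' ∈ (T : Set (Set X)), a ∈ T' ↔ x i j ∈ T') →
        (∀ T' ∈ (T : Set (Set X)), a' ∈ T' ↔ x i j' ∈ T') →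
        (∀ T' ∈ (T : Set (Set X)), a ∈ T' ↔ a' ∈ T') → j = j' := by
      intro a a' ha ha' haa
      refine hE' i j j' (hTE j' _ _ (fun T' hT' => ?_) (hxE i j'))
      rw [← ha T' hT', ← ha' T' hT', haa T' hT']
    have split : ∀ a b a' b', (∀ T' ∈ (T : Set (Set X)), a ∈ T' ↔ b ∈ T') →
        (∀ T' ∈ (T : Set (Set X)), a' ∈ T' ↔ b' ∈ T') → a ∈ S j → b ∉ S j → a' ∈ S j → b' ∉ S j →
        ∀ T' ∈ (T : Set (Set X)), a ∈ T' ↔ a' ∈ T' := fun a b a' b' h h' h1 h2 h3 h4 T' hT' =>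
      ⟨hF.mem_of_split hTF (hrF (hSr j)) h h1 h2 h3 hT',
        hF.mem_of_split hTF (hrF (hSr j)) h' h3 h4 h1 hT'⟩
    have hj := hS j
    have hj' := hS j'
    rw [← hjj] at hj'
    have s1 := hsame j
    have s2 := hsame j'
    have s1' := fun T' hT' => (s1 T' hT').symm
    have s2' := fun T' hT' => (s2 T' hT').symm
    -- In either column, either of the two points may be the one inside the splitting set; in each
    -- case the two inside points share a `T`-class.
    by_cases c : x i j ∈ S j <;> by_cases c' : x i j' ∈ S j
    · have d : x i' j ∉ S j := by tauto
      have d' : x i' j' ∉ S j := by tauto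
      exact key _ _ (fun _ _ => Iff.rfl) (fun _ _ => Iff.rfl) (split _ _ _ _ s1 s2 c d c' d')
    · have d : x i' j ∉ S j := by tauto
      have d' : x i' j' ∈ S j := by tauto
      exact key _ _ (fun _ _ => Iff.rfl) s2' (split _ _ _ _ s1 s2' c d d' c')
    · have d : x i' j ∈ S j := by tauto
      have d' : x i' j' ∉ S j := by tauto
      exact key _ _ s1' (fun _ _ => Iff.rfl) (split _ _ _ _ s1' s2 d c c' d')
    · have d : x i' j ∈ S j := by tauto
      have d' : x i' j' ∈ S j := by tauto
      exact key _ _ s1' s2' (split _ _ _ _ s1' s2' d c d' c')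
  calc Fintype.card κ = (Finset.univ.image S).card := by
        rw [Finset.card_image_of_injective _ hinj, Finset.card_univ]
    _ ≤ r.card := Finset.card_le_card fun s hs => by
        obtain ⟨j, -, rfl⟩ := Finset.mem_image.1 hs
        exact hSr j
    _ ≤ k := hrk

/-! ### Relative indices and the grid of cosets -/

/-- There are `m` elements of `L` in pairwise distinct cosets of `H`. -/
def HasDistinctCosets {M : Type u} [AddCommGroup M] (H L : AddSubgroup M) (m : ℕ) : Prop :=
  ∃ f : Fin m → M, (∀ i, f i ∈ L) ∧ ∀ i j, i ≠ j → f i - f j ∉ H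

theorem hasDistinctCosets_iff {M : Type u} [AddCommGroup M] (H L : AddSubgroup M) (m : ℕ) :
    HasDistinctCosets H L m ↔ (H.relIndex L = 0 ∨ m ≤ H.relIndex L) := by
  have h1 : HasDistinctCosets H L m ↔
      ∃ f : Fin m → L ⧸ H.addSubgroupOf L, Function.Injective f := by
    constructor
    · rintro ⟨f, hf, hf'⟩
      refine ⟨fun i => ((⟨f i, hf i⟩ : L) : L ⧸ H.addSubgroupOf L), fun i j hij => ?_⟩
      by_contra hne
      rw [QuotientAddGroup.eq] at hij
      refine hf' j i (Ne.symm hne) ?_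
      rw [AddSubgroup.mem_addSubgroupOf] at hij
      simpa [sub_eq_neg_add] using hij
    · rintro ⟨f, hf⟩
      refine ⟨fun i => ((f i).out : L), fun i => (f i).out.2, fun i j hne hij => hne ?_⟩
      apply hf
      rw [← (f i).out_eq', ← (f j).out_eq']
      symm
      apply QuotientAddGroup.eq.2
      rw [AddSubgroup.mem_addSubgroupOf]
      simpa [sub_eq_neg_add] using hij
  rw [h1, AddSubgroup.relIndex, AddSubgroup.index]
  constructor
  · rintro ⟨f, hf⟩
    rcases finite_or_infinite (L ⧸ H.addSubgroupOf L) with h | h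
    · right
      simpa using Nat.card_le_card_of_injective f hf
    · left
      exact Nat.card_eq_zero_of_infinite
  · intro h
    rcases finite_or_infinite (L ⧸ H.addSubgroupOf L) with h' | h'
    · have : m ≤ Nat.card (L ⧸ H.addSubgroupOf L) := h.resolve_left Nat.card_pos.ne'
      have e := Finite.equivFin (L ⧸ H.addSubgroupOf L)
      exact ⟨fun i => e.symm (Fin.castLE this i),
        e.symm.injective.comp (Fin.castLE_injective this)⟩
    · exact ⟨fun i => Infinite.natEmbedding _ i,
        (Infinite.natEmbedding _).injective.comp Fin.val_injective⟩

/-- This turns first-order statements "at least `m` cosets" into an equality of indices, infinite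
index included. -/
theorem relIndex_eq_of_hasDistinctCosets_iff {M : Type u} [AddCommGroup M] {H L : AddSubgroup M}
    {N : Type v} [AddCommGroup N] {H' L' : AddSubgroup N}
    (h : ∀ m, HasDistinctCosets H L m ↔ HasDistinctCosets H' L' m) :
    H.relIndex L = H'.relIndex L' := by
  simp only [hasDistinctCosets_iff] at h
  have h1 := h (H.relIndex L + 1)
  have h2 := h (H'.relIndex L' + 1)
  have h3 := h (H.relIndex L)
  have h4 := h (H'.relIndex L')
  omega

/-- In a group, the complexity of the cosets of `H` in a directed family bounds the index of `L`
in `H`, unless `H` has finite index in `L`. -/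
theorem DirectedFamily.relIndex_le {M : Type u} [AddCommGroup M] {F : Set (Set M)}
    (hF : DirectedFamily F) (H L : AddSubgroup M) (k : ℕ)
    (hH : ∀ a, ∃ t : Finset (Set M), ↑t ⊆ F ∧ t.card ≤ k ∧
      SeparatedBy (t : Set (Set M)) {x | x - a ∈ H})
    (hL : ∀ a, ∃ t : Finset (Set M), ↑t ⊆ F ∧ SeparatedBy (t : Set (Set M)) {x | x - a ∈ L})
    (h0 : H.relIndex L = 0) : L.relIndex H ≠ 0 ∧ L.relIndex H ≤ k := by
  by_contra hcon
  -- Infinite index and index above `k` are refuted together by `k + 1` columns.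
  have hk : HasDistinctCosets L H (k + 1) := by
    rw [hasDistinctCosets_iff]
    omega
  obtain ⟨b, hb, hb'⟩ := hk
  have : Infinite (L ⧸ H.addSubgroupOf L) := by
    by_contra hfin
    rw [not_infinite_iff_finite] at hfin
    exact Nat.card_pos.ne' h0
  -- Rows are cosets of `H` with representatives in `L`, columns are cosets of `L` with
  -- representatives `b j` in `H`; the sum of two representatives lies in both cosets.
  have := hF.card_le_of_grid (ι := L ⧸ H.addSubgroupOf L) (κ := Fin (k + 1))
    (fun i j => (i.out : M) + b j) (fun i => {x | x - (i.out : M) ∈ H}) (fun j => {x | x - b j ∈ L})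
    k (fun i => hH _) (fun j => hL _) (fun i j => by simpa using hb j)
    (fun i j => by simp)
    (fun i i' j hij => by
      have hij' : (i.out : M) + b j - (i'.out : M) ∈ H := hij
      rw [← i.out_eq', ← i'.out_eq']
      symm
      apply QuotientAddGroup.eq.2
      rw [AddSubgroup.mem_addSubgroupOf]
      have := H.sub_mem hij' (hb j)
      convert this using 1
      simp only [AddSubgroup.coe_add, AddSubgroup.coe_neg]
      abel)
    (fun i j j' hij => by
      by_contra hne
      have hij' : (i.out : M) + b j - b j' ∈ L := hij
      refine hb' j j' hne ?_
      have := L.sub_mem hij' i.out.2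
      convert this using 1
      abel)
  simp at this

/-! ### Extracting a chain of subgroups -/

/-- If for every member `H` of an intersection-closed countable family the members `L` meet `H` in
bounded index, unless `H` has finite index in `L`, then some chain in the family contains a finite
index subgroup of each member. -/
theorem exists_chain_of_relIndex_bounded {M : Type u} [AddCommGroup M] {P : Set (AddSubgroup M)}
    (hP : P.Countable) (hinf : ∀ H ∈ P, ∀ K ∈ P, H ⊓ K ∈ P)
    (hb : ∀ H ∈ P, ∃ N, ∀ L ∈ P, H.relIndex L ≠ 0 ∨ L.relIndex H ≠ 0 ∧ L.relIndex H ≤ N) :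
    ∃ F ⊆ P, IsChain (· ≤ ·) F ∧ ∀ H ∈ P, ∃ K ∈ F, K ≤ H ∧ K.relIndex H ≠ 0 := by
  classical
  have total : ∀ H ∈ P, ∀ L ∈ P, H.relIndex L ≠ 0 ∨ L.relIndex H ≠ 0 := fun H hH L hL =>
    (hb H hH).elim fun N h => (h L hL).imp_right And.left
  -- Among the `L` with `[L : H ∩ L]` infinite, take one maximizing the bounded index `[H : H ∩ L]`,
  -- and let `K = H ⊓ L`. Intersecting with another such `L'` cannot raise the index, so `K ≤ L'`.
  have core : ∀ H ∈ P, ∃ K ∈ P, K ≤ H ∧ K.relIndex H ≠ 0 ∧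
      ∀ L ∈ P, H.relIndex L = 0 → K ≤ L := by
    intro H hH
    obtain ⟨N, hN⟩ := hb H hH
    by_cases hex : ∃ L ∈ P, H.relIndex L = 0
    · let Q : ℕ → Prop := fun n => ∃ L ∈ P, H.relIndex L = 0 ∧ L.relIndex H = n
      obtain ⟨L0, hL0, h0⟩ := hex
      have hQ : ∃ n, n ≤ N ∧ Q n := ⟨_, ((hN L0 hL0).resolve_left (by simpa using h0)).2, L0, hL0, h0, rfl⟩
      obtain ⟨n0, hn0N, hn0⟩ := hQ
      obtain ⟨L, hL, hHL, hn⟩ := Nat.findGreatest_spec (P := Q) hn0N hn0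
      have hLH := (hN L hL).resolve_left (by simpa using hHL)
      refine ⟨H ⊓ L, hinf H hH L hL, inf_le_left, by rw [AddSubgroup.inf_relIndex_left]; exact hLH.1,
        fun L' hL' h' => ?_⟩
      have hLH' := (hN L' hL').resolve_left (by simpa using h')
      -- `L ⊓ L'` has finite index in `L` or in `L'`, so it competes in the same maximum.
      have hI : H.relIndex (L ⊓ L') = 0 := by
        rcases total L hL L' hL' with h | h
        · by_contra hc
          have h3 : (L ⊓ L').relIndex L' ≠ 0 := by rwa [AddSubgroup.inf_relIndex_right]
          exact AddSubgroup.relIndex_ne_zero_trans hc h3 h'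
        · by_contra hc
          have h3 : (L ⊓ L').relIndex L ≠ 0 := by rwa [AddSubgroup.inf_relIndex_left]
          exact AddSubgroup.relIndex_ne_zero_trans hc h3 hHL
      have hIH := (hN _ (hinf L hL L' hL')).resolve_left (by simpa using hI)
      have hle : (L ⊓ L').relIndex H ≤ L.relIndex H := by
        rw [hn]
        exact Nat.le_findGreatest hIH.2 ⟨_, hinf L hL L' hL', hI, rfl⟩
      have hmul := AddSubgroup.relIndex_inf_mul_relIndex L' L H
      rw [inf_comm L' L] at hmul
      have hpos : 0 < L.relIndex H := Nat.pos_of_ne_zero hLH.1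
      have hone : L'.relIndex (L ⊓ H) = 1 := by
        have h1 : L'.relIndex (L ⊓ H) ≠ 0 := by
          intro h
          rw [h, zero_mul] at hmul
          exact hIH.1 hmul.symm
        have h2 : L'.relIndex (L ⊓ H) ≤ 1 := by
          by_contra hc
          have : 2 * L.relIndex H ≤ L'.relIndex (L ⊓ H) * L.relIndex H :=
            Nat.mul_le_mul_right _ (by omega)
          omega
        omega
      rw [AddSubgroup.relIndex_eq_one, inf_comm] at hone
      exact hone
    · push Not at hex
      exact ⟨H, hH, le_rfl, by simp, fun L hL h => absurd h (hex L hL)⟩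
  choose! c hcP hcle hcfin hcmin using core
  rcases P.eq_empty_or_nonempty with rfl | hne
  · exact ⟨∅, by simp, by simp [IsChain], by simp⟩
  obtain ⟨e, rfl⟩ := hP.exists_eq_range hne
  -- Infinite indices already force inclusions through `c`. The remaining pairs, with both relative
  -- indices finite, are ordered by the enumeration: a later term is cut down by the earlier ones.
  let f : ℕ → AddSubgroup M := fun n =>
    c (e n) ⊓ ((Finset.range n).filter fun i => (e i).relIndex (e n) ≠ 0).inf fun i => c (e i)
  have hfle : ∀ n H, H ≤ f n ↔ H ≤ c (e n) ∧ ∀ i < n, (e i).relIndex (e n) ≠ 0 → H ≤ c (e i) := by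
    intro n H
    simp only [f]
    simp [Finset.le_inf_iff]
  have hfind : ∀ (s : Finset ℕ) (n : ℕ), (∀ i ∈ s, (e i).relIndex (e n) ≠ 0) →
      c (e n) ⊓ s.inf (fun i => c (e i)) ∈ Set.range e ∧
      (c (e n) ⊓ s.inf fun i => c (e i)).relIndex (e n) ≠ 0 := by
    intro s n
    induction s using Finset.induction_on with
    | empty => simpa using ⟨hcP _ ⟨n, rfl⟩, hcfin _ ⟨n, rfl⟩⟩
    | insert a s ha ih =>
      intro h
      obtain ⟨h1, h2⟩ := ih fun i hi => h i (Finset.mem_insert_of_mem hi)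
      rw [Finset.inf_insert, inf_left_comm]
      exact ⟨hinf _ (hcP _ ⟨a, rfl⟩) _ h1, AddSubgroup.relIndex_inf_ne_zero
        (AddSubgroup.relIndex_ne_zero_trans (hcfin _ ⟨a, rfl⟩) (h a (Finset.mem_insert_self _ _))) h2⟩
  have hf : ∀ n, f n ∈ Set.range e ∧ (f n).relIndex (e n) ≠ 0 := fun n =>
    hfind _ n fun i hi => (Finset.mem_filter.1 hi).2
  have key : ∀ n m, (e n).relIndex (e m) = 0 → f n ≤ f m := by
    intro n m h
    refine ((hfle n _).1 le_rfl).1.trans (hcmin _ ⟨n, rfl⟩ _ (hf m).1 ?_)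
    by_contra hc
    exact AddSubgroup.relIndex_ne_zero_trans hc (hf m).2 h
  have key2 : ∀ n m, n < m → (e n).relIndex (e m) ≠ 0 → f m ≤ f n := by
    intro n m hnm h
    rw [hfle]
    have := (hfle m _).1 le_rfl
    exact ⟨this.2 n hnm h, fun i hi hin =>
      this.2 i (hi.trans hnm) (AddSubgroup.relIndex_ne_zero_trans hin h)⟩
  refine ⟨Set.range f, ?_, ?_, ?_⟩
  · rintro _ ⟨n, rfl⟩
    exact (hf n).1
  · rintro _ ⟨n, rfl⟩ _ ⟨m, rfl⟩ hnm
    by_cases h1 : (e n).relIndex (e m) = 0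
    · exact Or.inl (key n m h1)
    by_cases h2 : (e m).relIndex (e n) = 0
    · exact Or.inr (key m n h2)
    rcases lt_trichotomy n m with h | rfl | h
    · exact Or.inr (key2 n m h h1)
    · exact absurd rfl hnm
    · exact Or.inl (key2 m n h h2)
  · rintro _ ⟨n, rfl⟩
    exact ⟨f n, ⟨n, rfl⟩, ((hfle n _).1 le_rfl).1.trans (hcle _ ⟨n, rfl⟩), (hf n).2⟩

/-! ### Coverings by cosets and projections -/

/-- `X` is empty or a coset of `K`. -/
def IsCosetOrEmpty {M : Type u} [AddCommGroup M] (K : AddSubgroup M) (X : Set M) : Prop :=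
  ∀ x ∈ X, ∀ y, y ∈ X ↔ y - x ∈ K

/-- The cosets of members of `P`, together with the empty set. -/
def cosetFamily {M : Type u} [AddCommGroup M] (P : Set (AddSubgroup M)) : Set (Set M) :=
  {X | ∃ K ∈ P, IsCosetOrEmpty K X}

theorem AddSubgroup.mem_finset_inf {M : Type u} [AddCommGroup M] {ι : Type w} {s : Finset ι} {K : ι → AddSubgroup M}
    {x : M} : x ∈ s.inf K ↔ ∀ i ∈ s, x ∈ K i := by
  simp [Finset.inf_eq_iInf, AddSubgroup.mem_iInf]

namespace IsCosetOrEmpty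

variable {M : Type u} [AddCommGroup M] {N : Type v} [AddCommGroup N]

theorem preimage {K : AddSubgroup M} {X : Set M} (h : IsCosetOrEmpty K X) (f : N →+ M) (c : M) :
    IsCosetOrEmpty (K.comap f) {x | c + f x ∈ X} := by
  intro x hx y
  change c + f y ∈ X ↔ f (y - x) ∈ K
  rw [h _ hx, map_sub, add_sub_add_left_eq_sub]

theorem image {K : AddSubgroup M} {X : Set M} (h : IsCosetOrEmpty K X) (f : M →+ N) :
    IsCosetOrEmpty (K.map f) (f '' X) := by
  rintro _ ⟨x, hx, rfl⟩ y
  constructor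
  · rintro ⟨z, hz, rfl⟩
    exact ⟨z - x, (h x hx z).1 hz, map_sub f z x⟩
  · rintro ⟨d, hd, hdy⟩
    exact ⟨d + x, (h x hx _).2 (by simpa using hd), by rw [map_add, hdy, sub_add_cancel]⟩

theorem finset_inf {ι : Type w} (s : Finset ι) {K : ι → AddSubgroup M} {X : ι → Set M}
    (h : ∀ i ∈ s, IsCosetOrEmpty (K i) (X i)) : IsCosetOrEmpty (s.inf K) (⋂ i ∈ s, X i) := by
  intro x hx y
  simp only [Set.mem_iInter, AddSubgroup.mem_finset_inf] at hx ⊢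
  exact forall₂_congr fun i hi => h i hi x (hx i hi) y

open scoped Pointwise in
theorem eq_vadd {K : AddSubgroup M} {X : Set M} (h : IsCosetOrEmpty K X) {x : M} (hx : x ∈ X) :
    x +ᵥ (K : Set M) = X := by
  ext y
  rw [h x hx y, Set.mem_vadd_set_iff_neg_vadd_mem, vadd_eq_add, SetLike.mem_coe, neg_add_eq_sub]

open scoped Pointwise in
/-- Whether finitely many cosets cover the group depends only on which of them have a common
point. -/
theorem iUnion_eq_univ {ι : Type w} (s : Finset ι) {K : ι → AddSubgroup M} {X Y : ι → Set M}
    (hX : ∀ i ∈ s, IsCosetOrEmpty (K i) (X i)) (hY : ∀ i ∈ s, IsCosetOrEmpty (K i) (Y i))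
    (h : ∀ t ⊆ s, (⋂ i ∈ t, X i).Nonempty ↔ (⋂ i ∈ t, Y i).Nonempty)
    (hcov : ⋃ i ∈ s, X i = Set.univ) : ⋃ i ∈ s, Y i = Set.univ := by
  classical
  -- Neumann's lemma: the cosets of infinite index are redundant in the covering.
  have hfi : ∀ x, ∃ i ∈ s, (K i).FiniteIndex ∧ x ∈ X i := by
    let s₁ := s.filter fun i => (X i).Nonempty
    have hg : ∀ i, ∃ g, (X i).Nonempty → g ∈ X i := fun i => by
      by_cases hi : (X i).Nonempty
      · exact ⟨hi.some, fun _ => hi.some_mem⟩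
      · exact ⟨0, fun h => absurd h hi⟩
    choose g hg using hg
    have hc : ⋃ i ∈ s₁, g i +ᵥ (K i : Set M) = Set.univ := by
      rw [Set.eq_univ_iff_forall] at hcov ⊢
      intro x
      obtain ⟨i, hi, hx⟩ := Set.mem_iUnion₂.1 (hcov x)
      refine Set.mem_iUnion₂.2 ⟨i, Finset.mem_filter.2 ⟨hi, x, hx⟩, ?_⟩
      rwa [(hX i hi).eq_vadd (hg i ⟨x, hx⟩)]
    have := AddSubgroup.leftCoset_cover_filter_FiniteIndex hc
    intro x
    obtain ⟨i, hi, hx⟩ := Set.mem_iUnion₂.1 (Set.eq_univ_iff_forall.1 this x)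
    rw [Finset.mem_filter, Finset.mem_filter] at hi
    rw [(hX i hi.1.1).eq_vadd (hg i hi.1.2)] at hx
    exact ⟨i, hi.1.1, hi.2, hx⟩
  let s' := s.filter fun i => (K i).FiniteIndex
  have hs' : s' ⊆ s := Finset.filter_subset _ _
  have : ∀ i : s', (K i).FiniteIndex := fun i => (Finset.mem_filter.1 i.2).2
  -- Modulo this finite index subgroup the surviving cosets become subsets of a finite group, where
  -- covering can be decided by counting.
  let K₀ : AddSubgroup M := ⨅ i : s', K i
  have hK₀ : ∀ i ∈ s', K₀ ≤ K i := fun i hi => iInf_le (fun i : s' => K i) ⟨i, hi⟩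
  have : K₀.FiniteIndex := AddSubgroup.finiteIndex_iInf this
  have := Fintype.ofFinite (M ⧸ K₀)
  let q : (ι → Set M) → ι → Finset (M ⧸ K₀) := fun Z i => Finset.univ.filter fun a => a.out ∈ Z i
  have hq : ∀ Z : ι → Set M, (∀ i ∈ s, IsCosetOrEmpty (K i) (Z i)) → ∀ i ∈ s', ∀ x : M,
      (x : M ⧸ K₀) ∈ q Z i ↔ x ∈ Z i := by
    intro Z hZ i hi x
    have hx : (x : M ⧸ K₀).out - x ∈ K i := by
      refine hK₀ i hi ?_
      have := QuotientAddGroup.eq.1 (QuotientAddGroup.out_eq' (x : M ⧸ K₀)).symm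
      rwa [neg_add_eq_sub] at this
    simp only [q, Finset.mem_filter, Finset.mem_univ, true_and]
    constructor
    · intro hz
      rw [hZ i (hs' hi) _ hz, ← neg_sub]
      exact (K i).neg_mem hx
    · intro hz
      rwa [hZ i (hs' hi) _ hz]
  have hcard : ∀ t ∈ s'.powerset, (t.inf (q X)).card = (t.inf (q Y)).card := by
    intro t ht
    rw [Finset.mem_powerset] at ht
    have hmem : ∀ Z : ι → Set M, (∀ i ∈ s, IsCosetOrEmpty (K i) (Z i)) → ∀ x : M,
        (x : M ⧸ K₀) ∈ t.inf (q Z) ↔ x ∈ ⋂ i ∈ t, Z i := by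
      intro Z hZ x
      simp only [Finset.mem_inf, Set.mem_iInter]
      exact forall₂_congr fun i hi => hq Z hZ i (ht hi) x
    by_cases hne : (⋂ i ∈ t, X i).Nonempty
    · obtain ⟨y, hy⟩ := (h t (ht.trans hs')).1 hne
      obtain ⟨x, hx⟩ := hne
      -- Both intersections are cosets of the same subgroup, so translation by `y - x` matches them.
      refine Finset.card_equiv (Equiv.addRight ((y - x : M) : M ⧸ K₀)) fun a => ?_
      induction a using QuotientAddGroup.induction_on with
      | H g =>
      change _ ↔ ((g + (y - x) : M) : M ⧸ K₀) ∈ _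
      rw [hmem X hX, hmem Y hY,
        finset_inf t (fun i hi => hX i (hs' (ht hi))) x hx,
        finset_inf t (fun i hi => hY i (hs' (ht hi))) y hy]
      congr! 1
      abel
    · have hne' := mt (h t (ht.trans hs')).2 hne
      have : ∀ Z : ι → Set M, (∀ i ∈ s, IsCosetOrEmpty (K i) (Z i)) → ¬ (⋂ i ∈ t, Z i).Nonempty →
          t.inf (q Z) = ∅ := by
        intro Z hZ hZ'
        rw [Finset.eq_empty_iff_forall_notMem]
        intro a
        induction a using QuotientAddGroup.induction_on with
        | H g =>
        rw [hmem Z hZ]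
        exact fun hg => hZ' ⟨g, hg⟩
      rw [this X hX hne, this Y hY hne']
  have hz : (s'.inf fun i => (q X i)ᶜ).card = 0 := by
    rw [Finset.card_eq_zero, Finset.eq_empty_iff_forall_notMem]
    intro a
    induction a using QuotientAddGroup.induction_on with
    | H g =>
    obtain ⟨i, hi, hi', hg⟩ := hfi g
    have his : i ∈ s' := Finset.mem_filter.2 ⟨hi, hi'⟩
    rw [Finset.mem_inf]
    intro hh
    exact Finset.mem_compl.1 (hh i his) ((hq X hX i his g).2 hg)
  -- Inclusion-exclusion expresses the size of the uncovered part through the sizes of the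
  -- intersections.
  have hz' : (s'.inf fun i => (q Y i)ᶜ).card = 0 := by
    rw [← Nat.cast_inj (R := ℤ), Finset.inclusion_exclusion_card_inf_compl] at hz ⊢
    rw [← hz]
    exact Finset.sum_congr rfl fun t ht => by rw [hcard t ht]
  rw [Finset.card_eq_zero, Finset.eq_empty_iff_forall_notMem] at hz'
  rw [Set.eq_univ_iff_forall]
  intro g
  have := hz' (g : M ⧸ K₀)
  rw [Finset.mem_inf] at this
  push Not at this
  obtain ⟨i, hi, hg⟩ := this
  exact Set.mem_iUnion₂.2 ⟨i, hs' hi, (hq Y hY i hi g).1 (by simpa using hg)⟩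

end IsCosetOrEmpty

/-- Boolean combinations of cosets are stable under projection. -/
theorem image_fst_mem_closure_cosetFamily {E : Type u} [AddCommGroup E] {M : Type v}
    [AddCommGroup M] {P : Set (AddSubgroup (E × M))} (htop : ⊤ ∈ P)
    (hinf : ∀ H ∈ P, ∀ K ∈ P, H ⊓ K ∈ P) {S : Set (E × M)}
    (hS : S ∈ BooleanSubalgebra.closure (cosetFamily P)) :
    Prod.fst '' S ∈
      BooleanSubalgebra.closure (cosetFamily (AddSubgroup.map (AddMonoidHom.fst E M) '' P)) := by
  classical
  obtain ⟨t, htP, ht⟩ := exists_separatedBy_of_mem_closure hS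
  have hK : ∀ T : Set (E × M), ∃ K, T ∈ t → K ∈ P ∧ IsCosetOrEmpty K T := fun T => by
    by_cases hT : T ∈ t
    · obtain ⟨K, hK⟩ := htP hT
      exact ⟨K, fun _ => hK⟩
    · exact ⟨⊤, fun h => absurd h hT⟩
  choose K hK using hK
  -- The projection is separated by the projections of all intersections of subfamilies of `t`.
  refine mem_closure_of_separatedBy
    (t := (fun r : Finset (Set (E × M)) => Prod.fst '' ⋂ T ∈ r, T) '' (t.powerset : Set _))
    ((Finset.finite_toSet _).image _) ?_ ?_
  · rintro _ ⟨r, hr, rfl⟩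
    rw [Finset.mem_coe, Finset.mem_powerset] at hr
    refine BooleanSubalgebra.subset_closure ⟨_, ⟨r.inf K, ?_, rfl⟩,
      (IsCosetOrEmpty.finset_inf r fun T hT => (hK T (hr hT)).2).image (AddMonoidHom.fst E M)⟩
    exact Finset.inf_induction htop hinf fun T hT => (hK T (hr hT)).1
  · rintro e e' hee ⟨⟨e₁, x⟩, hx, rfl : e₁ = e⟩
    have hpat : ∀ r ⊆ t, (∃ y, ∀ T ∈ r, (e₁, y) ∈ T) ↔ ∃ y, ∀ T ∈ r, (e', y) ∈ T := by
      intro r hr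
      simpa using hee _ ⟨r, by simpa using hr, rfl⟩
    let p := t.filter fun T => (e₁, x) ∈ T
    have hp : p ⊆ t := Finset.filter_subset _ _
    obtain ⟨x', hx'⟩ := (hpat p hp).1 ⟨x, fun T hT => (Finset.mem_filter.1 hT).2⟩
    -- The fibres of `⋂ p` over `e₁` and `e'` are both cosets of `G`. If no point over `e'` had
    -- pattern exactly `p`, the sets outside `p` would cover its fibre;
    -- `IsCosetOrEmpty.iUnion_eq_univ` carries the covering to the fibre over `e₁`, where `x` is
    -- uncovered.
    let G : AddSubgroup M := (p.inf K).comap (AddMonoidHom.inr E M)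
    have hG : ∀ a y, (∀ T ∈ p, (a, y) ∈ T) → ∀ z, (∀ T ∈ p, (a, z) ∈ T) ↔ z - y ∈ G := by
      intro a y hy z
      have := IsCosetOrEmpty.finset_inf p (fun T hT => (hK T (hp hT)).2) (a, y) (by simpa using hy)
        (a, z)
      simpa [G] using this
    have hce : ∀ a y, ∀ T ∈ t \ p, IsCosetOrEmpty
        (((K T).comap (AddMonoidHom.inr E M)).comap G.subtype) {g : G | (a, y + (g : M)) ∈ T} := by
      intro a y T hT
      have := (hK T (Finset.mem_sdiff.1 hT).1).2.preimage
        ((AddMonoidHom.inr E M).comp G.subtype) (a, y)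
      simpa [← AddSubgroup.comap_comap] using this
    have hint : ∀ a y, (∀ T ∈ p, (a, y) ∈ T) → ∀ r ⊆ t \ p,
        ((⋂ T ∈ r, {g : G | (a, y + (g : M)) ∈ T}).Nonempty ↔ ∃ z, ∀ T ∈ p ∪ r, (a, z) ∈ T) := by
      intro a y hy r hr
      constructor
      · rintro ⟨g, hg⟩
        refine ⟨y + g, fun T hT => ?_⟩
        rcases Finset.mem_union.1 hT with hT | hT
        · exact (hG a y hy _).2 (by simp) T hT
        · simp only [Set.mem_iInter] at hg
          exact hg T hT
      · rintro ⟨z, hz⟩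
        refine ⟨⟨z - y, (hG a y hy z).1 fun T hT => hz T (Finset.mem_union_left _ hT)⟩, ?_⟩
        simp only [Set.mem_iInter]
        intro T hT
        simpa using hz T (Finset.mem_union_right _ hT)
    have hxp : ∀ T ∈ p, (e₁, x) ∈ T := fun T hT => (Finset.mem_filter.1 hT).2
    by_contra hcon
    have hcov' : ⋃ T ∈ t \ p, {g : G | (e', x' + (g : M)) ∈ T} = Set.univ := by
      rw [Set.eq_univ_iff_forall]
      intro g
      by_contra hg
      simp only [Set.mem_iUnion, not_exists] at hg
      refine hcon ⟨(e', x' + g), ht _ _ (fun T hT => ?_) hx, rfl⟩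
      by_cases hTp : T ∈ p
      · exact iff_of_true (hxp T hTp) ((hG e' x' hx' _).2 (by simp) T hTp)
      · exact iff_of_false (fun h => hTp (Finset.mem_filter.2 ⟨hT, h⟩))
          (hg T (Finset.mem_sdiff.2 ⟨hT, hTp⟩))
    have hcov := IsCosetOrEmpty.iUnion_eq_univ (t \ p) (hce e' x') (hce e₁ x)
      (fun r hr => by
        rw [hint e' x' hx' r hr, hint e₁ x hxp r hr, hpat]
        exact Finset.union_subset hp (hr.trans Finset.sdiff_subset)) hcov'
    obtain ⟨T, hT, h0⟩ := Set.mem_iUnion₂.1 (Set.eq_univ_iff_forall.1 hcov 0)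
    obtain ⟨hTt, hTp⟩ := Finset.mem_sdiff.1 hT
    exact hTp (Finset.mem_filter.2 ⟨hTt, by simpa using h0⟩)

/-! ### Ultraproducts and transfer between models of a complete theory -/

section General

open FirstOrder FirstOrder.Language

variable {L : FirstOrder.Language.{u, v}}

/-- Being an ultraproduct of sets that are separated by boundedly many instances of `Ψ`. -/
theorem exists_internal_of_mem_closure {Ψ : Set (PartitionedFormula L)} (U : Ultrafilter ℕ)
    (M : ℕ → Type w) [∀ n, L.Structure (M n)] [∀ n, Nonempty (M n)]
    {s : Set ((U : Filter ℕ).Product M)}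
    (hs : s ∈ BooleanSubalgebra.closure (instanceFamily Ψ ((U : Filter ℕ).Product M))) :
    ∃ (k : ℕ) (S : ∀ n, Set (M n)),
      (∀ n, ∃ t : Finset (Set (M n)), ↑t ⊆ instanceFamily Ψ (M n) ∧ t.card ≤ k ∧
        SeparatedBy (t : Set (Set (M n))) (S n)) ∧
      ∀ x : ∀ n, M n, (x : (U : Filter ℕ).Product M) ∈ s ↔ ∀ᶠ n in U, x n ∈ S n := by
  classical
  induction hs using BooleanSubalgebra.closure_bot_sup_induction with
  | mem s hs =>
    obtain ⟨ψ, hψ, a, rfl⟩ := hs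
    choose b hb using fun i => Quotient.exists_rep (a i)
    refine ⟨1, fun n => ψ.instanceSet fun i => b i n, fun n => ⟨{ψ.instanceSet fun i => b i n}, ?_,
      by simp, .of_mem (by simp)⟩, fun x => ?_⟩
    · simpa using ⟨ψ, hψ, _, rfl⟩
    · have := Ultraproduct.realize_formula_cast (M := M) (u := U) ψ.2
        (Sum.elim (fun _ => x) b)
      have h1 : (fun i => ((Sum.elim (fun _ => x) b i : ∀ n, M n) : (U : Filter ℕ).Product M)) =
          Sum.elim (fun _ : Unit => (x : (U : Filter ℕ).Product M)) a := by
        funext i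
        rcases i with i | i
        · rfl
        · exact hb i
      have h2 : ∀ n, (fun i => (Sum.elim (fun _ => x) b i : ∀ n, M n) n) =
          Sum.elim (fun _ : Unit => x n) fun i => b i n := by
        intro n
        funext i
        rcases i with i | i <;> rfl
      rw [h1] at this
      simp only [h2] at this
      exact this
  | bot => exact ⟨0, fun _ => ∅, fun n => ⟨∅, by simp, by simp, fun _ _ _ h => h⟩,
      fun x => iff_of_false (Set.notMem_empty _) (by simpa using U.neBot.ne)⟩
  | sup s hs s' hs' h h' =>
    obtain ⟨k, S, hS, hx⟩ := h
    obtain ⟨k', S', hS', hx'⟩ := h'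
    refine ⟨k + k', fun n => S n ∪ S' n, fun n => ?_, fun x => ?_⟩
    · obtain ⟨t, ht, htk, hts⟩ := hS n
      obtain ⟨t', ht', htk', hts'⟩ := hS' n
      exact ⟨t ∪ t', by simp [ht, ht'], (Finset.card_union_le _ _).trans (by omega),
        (hts.mono (by simp)).union (hts'.mono (by simp))⟩
    · simp only [Set.mem_union, Ultrafilter.eventually_or]
      exact or_congr (hx x) (hx' x)
  | compl s hs h =>
    obtain ⟨k, S, hS, hx⟩ := h
    refine ⟨k, fun n => (S n)ᶜ, fun n => ?_, fun x => ?_⟩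
    · obtain ⟨t, ht, htk, hts⟩ := hS n
      exact ⟨t, ht, htk, hts.compl⟩
    · simp only [Set.mem_compl_iff, Ultrafilter.eventually_not]
      exact not_congr (hx x)

theorem PartitionedFormula.definable_instanceSet {M : Type w} [L.Structure M]
    (θ : PartitionedFormula L) (c : Fin θ.1 → M) :
    Set.Definable₁ (Set.univ : Set M) L (θ.instanceSet c) := by
  rw [Set.Definable₁, Set.definable_iff_exists_formula_sum]
  refine ⟨θ.2.subst (Sum.elim (fun _ => Term.var (Sum.inr 0))
    fun i => Term.var (Sum.inl ⟨c i, Set.mem_univ _⟩)), ?_⟩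
  ext x
  simp only [PartitionedFormula.instanceSet, Set.mem_ofPred_eq]
  rw [Formula.Realize, Formula.Realize, BoundedFormula.realize_subst]
  refine iff_of_eq (congrArg (fun v => BoundedFormula.Realize θ.2 v default) ?_)
  funext i
  rcases i with i | i <;> rfl

/-- If the instances of `Ψ` generate all definable sets in all models, then the number of instances
needed for `θ(M; c)` is bounded. -/
theorem exists_card_bound {T : L.Theory} {Ψ : Set (PartitionedFormula L)}
    (hΨ : ∀ (M : Theory.ModelType.{u, v, max u v w} T) (s : Set M),
      Set.Definable₁ (Set.univ : Set M) L s → s ∈ BooleanSubalgebra.closure (instanceFamily Ψ M))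
    (θ : PartitionedFormula L) :
    ∃ k : ℕ, ∀ (M : Theory.ModelType.{u, v, max u v w} T) (c : Fin θ.1 → M),
      ∃ t : Finset (Set M), ↑t ⊆ instanceFamily Ψ M ∧ t.card ≤ k ∧
        SeparatedBy (t : Set (Set M)) (θ.instanceSet c) := by
  by_contra! hcon
  choose M c hc using hcon
  -- Counterexamples `M n` to the bound `n` are glued by a nonprincipal ultrafilter; the bound `k`
  -- found in the ultraproduct then contradicts some `n ≥ k`.
  let U : Ultrafilter ℕ := Filter.hyperfilter ℕ
  let N := (U : Filter ℕ).Product fun n => (M n : Type max u v w)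
  have hN : N ⊨ T := by
    rw [Theory.model_iff]
    intro φ hφ
    rw [Ultraproduct.sentence_realize]
    exact Filter.Eventually.of_forall fun n => Theory.realize_sentence_of_mem T hφ
  let C : Fin θ.1 → N := fun i => ((fun n => c n i : ∀ n, M n) : (U : Filter ℕ).Product _)
  obtain ⟨k, S, hS, hx⟩ := exists_internal_of_mem_closure U (fun n => (M n : Type max u v w))
    (hΨ (Theory.ModelType.of T N) _ (θ.definable_instanceSet C))
  have hC : ∀ x : ∀ n, M n, (x : (U : Filter ℕ).Product _) ∈ θ.instanceSet C ↔
      ∀ᶠ n in U, x n ∈ θ.instanceSet (c n) := by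
    intro x
    have := Ultraproduct.realize_formula_cast (M := fun n => (M n : Type max u v w)) (u := U) θ.2
      (Sum.elim (fun _ => x) fun i n => c n i)
    have h1 : (fun i => ((Sum.elim (fun _ => x) (fun i n => c n i) i : ∀ n, M n) :
        (U : Filter ℕ).Product _)) =
        Sum.elim (fun _ : Unit => (x : (U : Filter ℕ).Product _)) C := by
      funext i
      rcases i with i | i <;> rfl
    have h2 : ∀ n, (fun i => (Sum.elim (fun _ => x) (fun i n => c n i) i : ∀ n, M n) n) =
        Sum.elim (fun _ : Unit => x n) (c n) := by
      intro n
      funext i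
      rcases i with i | i <;> rfl
    rw [h1] at this
    simp only [h2] at this
    exact this
  -- Two internal sets with the same elements agree almost everywhere: otherwise a choice of points
  -- from the differences gives an element of exactly one.
  have heq : ∀ᶠ n in U, S n = θ.instanceSet (c n) := by
    by_contra hne
    have hex : ∀ n, ∃ x : M n, S n ≠ θ.instanceSet (c n) →
        ¬ (x ∈ S n ↔ x ∈ θ.instanceSet (c n)) := by
      intro n
      by_cases h : S n = θ.instanceSet (c n)
      · exact ⟨Classical.arbitrary _, fun h' => absurd h h'⟩
      · by_contra! hall
        exact h (Set.ext fun x => (hall x).2)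
    choose x hxne using hex
    have h1 : ∀ᶠ n in U, x n ∈ S n ↔ x n ∈ θ.instanceSet (c n) := by
      have := (hx x).symm.trans (hC x)
      by_cases h : ∀ᶠ n in U, x n ∈ S n
      · filter_upwards [h, this.1 h] with n a b using iff_of_true a b
      · have h' := mt this.2 h
        rw [← Ultrafilter.eventually_not] at h h'
        filter_upwards [h, h'] with n a b using iff_of_false a b
    refine hne ?_
    filter_upwards [h1] with n hn
    by_contra h
    exact hxne n h hn
  have hge : ∀ᶠ n in U, k ≤ n :=
    Filter.Eventually.filter_mono Nat.hyperfilter_le_atTop (Filter.eventually_ge_atTop k)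
  obtain ⟨n, hn, hkn⟩ := (heq.and hge).exists
  obtain ⟨t, ht, htk, hts⟩ := hS n
  exact hc n t ht (htk.trans hkn) (hn ▸ hts)

/-- The sentence asserting that `φ` is satisfied by some tuple. -/
noncomputable def existsSentence {β : Type*} [Finite β] (φ : L.Formula β) : L.Sentence :=
  Formula.iExs β (φ.subst fun b => Term.var (Sum.inr b))

theorem realize_existsSentence {X : Type w} [L.Structure X] {β : Type*} [Finite β]
    (φ : L.Formula β) : X ⊨ existsSentence φ ↔ ∃ v : β → X, φ.Realize v := by
  rw [Sentence.Realize, existsSentence, Formula.realize_iExs]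
  simp only [Formula.Realize, BoundedFormula.realize_subst]
  rfl

variable {A : Type w} [L.Structure A] {N : Type*} [L.Structure N] [N ⊨ L.completeTheory A]

theorem exists_realize_iff_of_model_completeTheory {β : Type*} [Finite β] (φ : L.Formula β) :
    (∃ v : β → N, φ.Realize v) ↔ ∃ v : β → A, φ.Realize v := by
  rw [← realize_existsSentence, ← realize_existsSentence]
  exact realize_iff_of_model_completeTheory A N _

theorem forall_realize_iff_of_model_completeTheory {β : Type*} [Finite β] (φ : L.Formula β) :
    (∀ v : β → N, φ.Realize v) ↔ ∀ v : β → A, φ.Realize v := by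
  have := exists_realize_iff_of_model_completeTheory (A := A) (N := N) φ.not
  simp only [Formula.realize_not] at this
  simpa using not_congr this

end General

/-! ### Positive primitive formulas and their subgroups -/

section PurePP

open FirstOrder FirstOrder.Language

/-- The term `t + t'`. -/
def addTerm {β : Type u} (t t' : pureGroupLanguage.Term β) : pureGroupLanguage.Term β :=
  Term.func (l := 2) PureGroupFunc.add ![t, t']

theorem realize_addTerm {M : Type u} [Add M] {β : Type v} (t t' : pureGroupLanguage.Term β)
    (v : β → M) : (addTerm t t').realize v = t.realize v + t'.realize v := rfl

/-- Positive primitive formulas of the pure group language. -/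
inductive IsPP {α : Type u} : ∀ {n : ℕ}, pureGroupLanguage.BoundedFormula α n → Prop
  | equal {n : ℕ} (t t' : pureGroupLanguage.Term (α ⊕ Fin n)) : IsPP (t.bdEqual t')
  | inf {n : ℕ} {φ ψ : pureGroupLanguage.BoundedFormula α n} :
      IsPP φ → IsPP ψ → IsPP (φ ⊓ ψ)
  | ex {n : ℕ} {φ : pureGroupLanguage.BoundedFormula α (n + 1)} : IsPP φ → IsPP φ.ex

theorem IsPP.subst {α : Type u} {β : Type v} {n : ℕ} {φ : pureGroupLanguage.BoundedFormula α n}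
    (h : IsPP φ) (f : α → pureGroupLanguage.Term β) : IsPP (φ.subst f) := by
  induction h with
  | equal t t' => exact .equal _ _
  | inf _ _ h h' => exact .inf h h'
  | ex _ h => exact .ex h

theorem realize_term_sub {M : Type u} [AddCommGroup M] {β : Type v}
    (t : pureGroupLanguage.Term β) (v w : β → M) :
    t.realize (v - w) = t.realize v - t.realize w := by
  induction t with
  | var => rfl
  | @func l f ts ih =>
    match l, f with
    | 2, PureGroupFunc.add =>
      change (ts 0).realize (v - w) + (ts 1).realize (v - w) =
        ((ts 0).realize v + (ts 1).realize v) - ((ts 0).realize w + (ts 1).realize w)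
      rw [ih, ih, add_sub_add_comm]

theorem realize_term_zero {M : Type u} [AddCommGroup M] {β : Type v}
    (t : pureGroupLanguage.Term β) : t.realize (0 : β → M) = 0 := by
  have := realize_term_sub t (0 : β → M) 0
  rwa [sub_zero, sub_self] at this

theorem realize_term_prod {A : Type u} [AddCommGroup A] {B : Type v} [AddCommGroup B] {β : Type w}
    (t : pureGroupLanguage.Term β) (v : β → A × B) :
    t.realize v = (t.realize fun i => (v i).1, t.realize fun i => (v i).2) := by
  induction t with
  | var => rfl
  | @func l f ts ih =>
    match l, f with
    | 2, PureGroupFunc.add =>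
      change (ts 0).realize v + (ts 1).realize v = _
      rw [ih, ih]
      rfl

theorem IsPP.realize_zero {α : Type u} {n : ℕ} {φ : pureGroupLanguage.BoundedFormula α n}
    (h : IsPP φ) (M : Type v) [AddCommGroup M] : φ.Realize (0 : α → M) 0 := by
  induction h with
  | @equal n t t' =>
    rw [BoundedFormula.realize_bdEqual]
    have : (Sum.elim 0 0 : α ⊕ Fin n → M) = 0 := by
      funext i
      rcases i with i | i <;> rfl
    rw [this, realize_term_zero, realize_term_zero]
  | inf _ _ h h' => exact BoundedFormula.realize_inf.2 ⟨h, h'⟩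
  | ex _ h =>
    refine BoundedFormula.realize_ex.2 ⟨0, ?_⟩
    convert h using 1
    funext i
    refine Fin.lastCases ?_ (fun j => ?_) i <;> simp

theorem IsPP.realize_sub {α : Type u} {n : ℕ} {φ : pureGroupLanguage.BoundedFormula α n}
    (h : IsPP φ) {M : Type v} [AddCommGroup M] {v w : α → M} {xs ys : Fin n → M}
    (h₁ : φ.Realize v xs) (h₂ : φ.Realize w ys) : φ.Realize (v - w) (xs - ys) := by
  induction h with
  | equal t t' =>
    rw [BoundedFormula.realize_bdEqual] at h₁ h₂ ⊢
    have : (Sum.elim (v - w) (xs - ys) : _ → M) = Sum.elim v xs - Sum.elim w ys := by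
      funext i
      rcases i with i | i <;> rfl
    rw [this, realize_term_sub, realize_term_sub, h₁, h₂]
  | inf _ _ h h' =>
    rw [BoundedFormula.realize_inf] at h₁ h₂ ⊢
    exact ⟨h h₁.1 h₂.1, h' h₁.2 h₂.2⟩
  | ex _ h =>
    rw [BoundedFormula.realize_ex] at h₁ h₂ ⊢
    obtain ⟨a, ha⟩ := h₁
    obtain ⟨b, hb⟩ := h₂
    refine ⟨a - b, ?_⟩
    convert h ha hb using 1
    funext i
    refine Fin.lastCases ?_ (fun j => ?_) i <;> simp

/-- Equations and conjunctions are checked coordinatewise, and a witness in `A × B` is just a pair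
of witnesses. -/
theorem IsPP.realize_prod {α : Type w} {n : ℕ} {φ : pureGroupLanguage.BoundedFormula α n}
    (h : IsPP φ) {A : Type u} [AddCommGroup A] {B : Type v} [AddCommGroup B]
    (v : α → A × B) (xs : Fin n → A × B) :
    φ.Realize v xs ↔ φ.Realize (fun i => (v i).1) (fun i => (xs i).1) ∧
      φ.Realize (fun i => (v i).2) (fun i => (xs i).2) := by
  induction h with
  | @equal n t t' =>
    simp only [BoundedFormula.realize_bdEqual]
    have h1 : (fun i => (Sum.elim v xs i).1) = Sum.elim (fun i => (v i).1) fun i => (xs i).1 := by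
      funext i
      rcases i with i | i <;> rfl
    have h2 : (fun i => (Sum.elim v xs i).2) = Sum.elim (fun i => (v i).2) fun i => (xs i).2 := by
      funext i
      rcases i with i | i <;> rfl
    rw [realize_term_prod, realize_term_prod t', Prod.mk_inj, h1, h2]
  | inf _ _ h h' =>
    simp only [BoundedFormula.realize_inf, h, h']
    tauto
  | @ex n φ _ h =>
    simp only [BoundedFormula.realize_ex, h]
    have h1 : ∀ a : A × B, (fun i => (Fin.snoc (α := fun _ => A × B) xs a i).1) =
        Fin.snoc (α := fun _ => A) (fun i => (xs i).1) a.1 := by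
      intro a
      funext i
      refine Fin.lastCases ?_ (fun j => ?_) i <;> simp
    have h2 : ∀ a : A × B, (fun i => (Fin.snoc (α := fun _ => A × B) xs a i).2) =
        Fin.snoc (α := fun _ => B) (fun i => (xs i).2) a.2 := by
      intro a
      funext i
      refine Fin.lastCases ?_ (fun j => ?_) i <;> simp
    simp only [h1, h2]
    exact ⟨fun ⟨a, ha, hb⟩ => ⟨⟨_, ha⟩, ⟨_, hb⟩⟩, fun ⟨⟨a, ha⟩, ⟨b, hb⟩⟩ => ⟨(a, b), ha, hb⟩⟩

/-- The subgroup defined by a positive primitive formula. -/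
def IsPP.subgroup {α : Type u} {n : ℕ} {φ : pureGroupLanguage.BoundedFormula α n}
    (h : IsPP φ) (M : Type v) [AddCommGroup M] : AddSubgroup ((α → M) × (Fin n → M)) :=
  AddSubgroup.ofSub {p | φ.Realize p.1 p.2} ⟨0, h.realize_zero M⟩
    fun _ hp _ hq => by simpa [sub_eq_add_neg] using h.realize_sub hp hq

theorem IsPP.mem_subgroup {α : Type u} {n : ℕ} {φ : pureGroupLanguage.BoundedFormula α n}
    (h : IsPP φ) {M : Type v} [AddCommGroup M] {p : (α → M) × (Fin n → M)} :
    p ∈ h.subgroup M ↔ φ.Realize p.1 p.2 := Iff.rfl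

/-- Positive primitive formulas in two variables; the second one is to be set to zero. -/
abbrev UnaryPP : Type := {φ : pureGroupLanguage.Formula Bool // IsPP φ}

/-- The assignment sending `true` to `x` and `false` to `0`. -/
def boolSingle (M : Type u) [AddCommGroup M] : M →+ (Bool → M) × (Fin 0 → M) :=
  (AddMonoidHom.single (fun _ : Bool => M) true).prod 0

theorem boolSingle_apply {M : Type u} [AddCommGroup M] (x : M) :
    boolSingle M x = (fun b => cond b x 0, default) := by
  refine Prod.ext (funext fun b => ?_) (Subsingleton.elim _ _)
  cases b <;> simp [boolSingle]

/-- The subgroup `{x | φ(x, 0)}` of `M`. -/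
def UnaryPP.subgroup (φ : UnaryPP) (M : Type u) [AddCommGroup M] : AddSubgroup M :=
  (φ.2.subgroup M).comap (boolSingle M)

theorem UnaryPP.mem_subgroup (φ : UnaryPP) {M : Type u} [AddCommGroup M] {x : M} :
    x ∈ φ.subgroup M ↔ φ.1.Realize fun b => cond b x 0 := by
  rw [UnaryPP.subgroup, AddSubgroup.mem_comap, boolSingle_apply]
  rfl

theorem UnaryPP.subgroup_prod (φ : UnaryPP) (A : Type u) [AddCommGroup A] (B : Type v)
    [AddCommGroup B] : φ.subgroup (A × B) = (φ.subgroup A).prod (φ.subgroup B) := by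
  ext ⟨a, b⟩
  rw [AddSubgroup.mem_prod, φ.mem_subgroup, φ.mem_subgroup, φ.mem_subgroup, Formula.Realize,
    φ.2.realize_prod]
  refine and_congr (iff_of_eq ?_) (iff_of_eq ?_)
  · refine congr_arg₂ (BoundedFormula.Realize φ.1) (funext fun i => ?_) (Subsingleton.elim _ _)
    cases i <;> rfl
  · refine congr_arg₂ (BoundedFormula.Realize φ.1) (funext fun i => ?_) (Subsingleton.elim _ _)
    cases i <;> rfl

/-- Conjunction. -/
def UnaryPP.inf (φ ψ : UnaryPP) : UnaryPP := ⟨φ.1 ⊓ ψ.1, φ.2.inf ψ.2⟩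

theorem UnaryPP.subgroup_inf (φ ψ : UnaryPP) (M : Type u) [AddCommGroup M] :
    (φ.inf ψ).subgroup M = φ.subgroup M ⊓ ψ.subgroup M := by
  ext x
  rw [AddSubgroup.mem_inf, φ.mem_subgroup, ψ.mem_subgroup, UnaryPP.mem_subgroup]
  exact Formula.realize_inf

/-- The formula `φ(t, t')`. -/
def UnaryPP.apply {β : Type u} (φ : UnaryPP) (t t' : pureGroupLanguage.Term β) :
    pureGroupLanguage.Formula β :=
  φ.1.subst fun b => cond b t t'

theorem UnaryPP.realize_apply {β : Type u} (φ : UnaryPP) (t t' : pureGroupLanguage.Term β)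
    {M : Type v} [AddCommGroup M] (v : β → M) :
    (φ.apply t t').Realize v ↔ φ.1.Realize fun b => cond b (t.realize v) (t'.realize v) := by
  rw [UnaryPP.apply, Formula.Realize, BoundedFormula.realize_subst]
  refine iff_of_eq (congrArg (fun v => BoundedFormula.Realize φ.1 v default) (funext fun b => ?_))
  cases b <;> rfl

/-- The formula `φ(x + y, z)` with parameters `y` and `z`. -/
def UnaryPP.cosetFormula (φ : UnaryPP) : PartitionedFormula pureGroupLanguage :=
  ⟨2, φ.apply (addTerm (Term.var (Sum.inl ())) (Term.var (Sum.inr 0))) (Term.var (Sum.inr 1))⟩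

theorem UnaryPP.mem_instanceSet (φ : UnaryPP) {M : Type u} [AddCommGroup M] (c : Fin 2 → M)
    (x : M) : x ∈ φ.cosetFormula.instanceSet c ↔ φ.1.Realize fun b => cond b (x + c 0) (c 1) :=
  φ.realize_apply _ _ _

theorem UnaryPP.instanceSet_eq (φ : UnaryPP) {M : Type u} [AddCommGroup M] (a : M) :
    φ.cosetFormula.instanceSet ![-a, 0] = {x | x - a ∈ φ.subgroup M} := by
  ext x
  rw [φ.mem_instanceSet]
  simp [φ.mem_subgroup, sub_eq_add_neg]

/-- Directedness concerns all parameters, including nonzero values of `z`. Every instance is the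
preimage of a subgroup under an affine map. -/
theorem UnaryPP.isCosetOrEmpty_instanceSet (φ : UnaryPP) {M : Type u} [AddCommGroup M]
    (c : Fin 2 → M) : IsCosetOrEmpty (φ.subgroup M) (φ.cosetFormula.instanceSet c) := by
  have key : ∀ x, x ∈ φ.cosetFormula.instanceSet c ↔
      ((fun b => cond b (c 0) (c 1), 0) : (Bool → M) × (Fin 0 → M)) + boolSingle M x ∈
        φ.2.subgroup M := by
    intro x
    rw [φ.mem_instanceSet, boolSingle_apply, IsPP.mem_subgroup]
    refine iff_of_eq (congr_arg₂ (BoundedFormula.Realize φ.1) (funext fun b => ?_)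
      (Subsingleton.elim _ _))
    cases b <;> simp [add_comm]
  have hK : IsCosetOrEmpty (φ.2.subgroup M) (φ.2.subgroup M : Set ((Bool → M) × (Fin 0 → M))) := by
    intro x hx y
    simp only [SetLike.mem_coe] at hx ⊢
    exact ⟨fun hy => sub_mem hy hx, fun h => by simpa using add_mem h hx⟩
  have := hK.preimage (boolSingle M) (fun b => cond b (c 0) (c 1), 0)
  have hset : φ.cosetFormula.instanceSet c = {x | (fun b => cond b (c 0) (c 1), 0) +
    boolSingle M x ∈ (φ.2.subgroup M : Set ((Bool → M) × (Fin 0 → M)))} := Set.ext key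
  rw [hset]
  exact this

/-! ### Transfer of indices and of the group structure -/

/-- The formula asserting that `z` is zero and that the subgroup of `ψ` contains elements `xᵢ` in
distinct cosets of the subgroup of `φ`. -/
noncomputable def distinctCosetsFormula (φ ψ : UnaryPP) (m : ℕ) :
    pureGroupLanguage.Formula (Option (Bool × Fin m)) :=
  let z : pureGroupLanguage.Term (Option (Bool × Fin m)) := Term.var none
  let x : Fin m → pureGroupLanguage.Term (Option (Bool × Fin m)) := fun i => Term.var (some (true, i))
  -- `y i` plays the role of `-x i`, since only addition is in the language; `z + z = z` below
  -- forces `z = 0`.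
  let y : Fin m → pureGroupLanguage.Term (Option (Bool × Fin m)) := fun i => Term.var (some (false, i))
  Term.equal (addTerm z z) z ⊓
    (Formula.iInf (fun i : Fin m => Term.equal (addTerm (x i) (y i)) z) ⊓
      (Formula.iInf (fun i : Fin m => ψ.apply (x i) z) ⊓
        Formula.iInf (fun p : {p : Fin m × Fin m // p.1 ≠ p.2} =>
          (φ.apply (addTerm (x p.1.1) (y p.1.2)) z).not)))

theorem exists_realize_distinctCosetsFormula (φ ψ : UnaryPP) (m : ℕ) (M : Type u) [AddCommGroup M] :
    (∃ v : _ → M, (distinctCosetsFormula φ ψ m).Realize v) ↔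
      HasDistinctCosets (φ.subgroup M) (ψ.subgroup M) m := by
  have hsub : ∀ (χ : UnaryPP) (t : pureGroupLanguage.Term (Option (Bool × Fin m))) (v : _ → M),
      v none = 0 → ((χ.apply t (Term.var none)).Realize v ↔ t.realize v ∈ χ.subgroup M) := by
    intro χ t v h0
    rw [χ.realize_apply, χ.mem_subgroup, Term.realize_var, h0]
  simp only [distinctCosetsFormula, Formula.realize_inf, Formula.realize_iInf,
    Formula.realize_equal, Formula.realize_not, realize_addTerm]
  constructor
  · rintro ⟨v, h0, hneg, hmem, hne⟩
    simp only [Term.realize_var] at h0 hneg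
    have hz : v none = 0 := by simpa using h0
    refine ⟨fun i => v (some (true, i)), fun i => (hsub ψ _ v hz).1 (hmem i), fun i j hij hd => ?_⟩
    refine hne ⟨(i, j), hij⟩ ((hsub φ _ v hz).2 ?_)
    rw [realize_addTerm, Term.realize_var, Term.realize_var]
    have hj := hneg j
    rw [hz] at hj
    rwa [eq_neg_of_add_eq_zero_right hj, ← sub_eq_add_neg]
  · rintro ⟨f, hf, hne⟩
    let v : Option (Bool × Fin m) → M := fun o => o.elim 0 fun p => cond p.1 (f p.2) (- f p.2)
    have hz : v none = 0 := rfl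
    refine ⟨v, by simp [hz], fun i => by simp [v], fun i => (hsub ψ _ v hz).2 (hf i),
      fun p hp => hne p.1.1 p.1.2 p.2 ?_⟩
    have := (hsub φ _ v hz).1 hp
    rw [realize_addTerm, Term.realize_var, Term.realize_var] at this
    rw [sub_eq_add_neg]
    exact this

theorem relIndex_subgroup_eq {A : Type u} [AddCommGroup A] {N : Type v} [AddCommGroup N]
    [N ⊨ groupTheory A] (φ ψ : UnaryPP) :
    (φ.subgroup N).relIndex (ψ.subgroup N) = (φ.subgroup A).relIndex (ψ.subgroup A) := by
  have : N ⊨ pureGroupLanguage.completeTheory A := ‹N ⊨ groupTheory A›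
  refine relIndex_eq_of_hasDistinctCosets_iff fun m => ?_
  rw [← exists_realize_distinctCosetsFormula, ← exists_realize_distinctCosetsFormula]
  exact exists_realize_iff_of_model_completeTheory _

theorem realize_addTerm_eq_funMap {M : Type u} [pureGroupLanguage.Structure M] {β : Type v}
    (t t' : pureGroupLanguage.Term β) (v : β → M) :
    (addTerm t t').realize v = Structure.funMap (L := pureGroupLanguage) (n := 2)
      PureGroupFunc.add ![t.realize v, t'.realize v] := by
  refine congrArg (Structure.funMap (L := pureGroupLanguage) (n := 2) PureGroupFunc.add)
    (funext fun i => ?_)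
  fin_cases i <;> rfl

/-- Every model of the theory of an abelian group is an abelian group. -/
theorem exists_addCommGroup_of_model (A : Type u) [AddCommGroup A] (N : Type v)
    [S : pureGroupLanguage.Structure N] [N ⊨ groupTheory A] [Nonempty N] :
    ∃ _ : AddCommGroup N, pureGroupStructure N = S := by
  have : N ⊨ pureGroupLanguage.completeTheory A := ‹N ⊨ groupTheory A›
  let add : N → N → N := fun a b =>
    Structure.funMap (L := pureGroupLanguage) (n := 2) PureGroupFunc.add ![a, b]
  have comm : ∀ a b, add a b = add b a := by
    let φ : pureGroupLanguage.Formula (Fin 2) := Term.equal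
      (addTerm (Term.var 0) (Term.var 1)) (addTerm (Term.var 1) (Term.var 0))
    have h := (forall_realize_iff_of_model_completeTheory (A := A) (N := N) φ).2 fun v => by
      simp only [φ, Formula.realize_equal, realize_addTerm, add_comm]
    intro a b
    have hab := h ![a, b]
    simp only [φ, Formula.realize_equal, realize_addTerm_eq_funMap] at hab
    exact hab
  have assoc : ∀ a b c, add (add a b) c = add a (add b c) := by
    let φ : pureGroupLanguage.Formula (Fin 3) := Term.equal
      (addTerm (addTerm (Term.var 0) (Term.var 1)) (Term.var 2))
      (addTerm (Term.var 0) (addTerm (Term.var 1) (Term.var 2)))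
    have h := (forall_realize_iff_of_model_completeTheory (A := A) (N := N) φ).2 fun v => by
      simp only [φ, Formula.realize_equal, realize_addTerm, add_assoc]
    intro a b c
    have habc := h ![a, b, c]
    simp only [φ, Formula.realize_equal, realize_addTerm_eq_funMap] at habc
    exact habc
  have solve : ∀ a b, ∃ x, add a x = b := by
    let φ : pureGroupLanguage.Formula (Fin 2) := Formula.iExs Unit (Term.equal
      (addTerm (Term.var (Sum.inl 0)) (Term.var (Sum.inr ()))) (Term.var (Sum.inl 1)))
    have h := (forall_realize_iff_of_model_completeTheory (A := A) (N := N) φ).2 fun v => by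
      simp only [φ, Formula.realize_iExs, Formula.realize_equal, realize_addTerm]
      exact ⟨fun _ => v 1 - v 0, add_sub_cancel _ _⟩
    intro a b
    have hab := h ![a, b]
    simp only [φ, Formula.realize_iExs, Formula.realize_equal, realize_addTerm_eq_funMap] at hab
    obtain ⟨i, hi⟩ := hab
    exact ⟨i (), hi⟩
  obtain ⟨a⟩ := ‹Nonempty N›
  obtain ⟨e, he⟩ := solve a a
  have zero : ∀ b, add e b = b := by
    intro b
    obtain ⟨x, rfl⟩ := solve a b
    rw [← assoc, comm e a, he]
  choose neg hneg using fun b => solve b e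
  refine ⟨{ add := add
            add_assoc := assoc
            zero := e
            zero_add := zero
            add_zero := fun b => (comm b e).trans (zero b)
            neg := neg
            neg_add_cancel := fun b => (comm _ _).trans (hneg b)
            add_comm := comm
            nsmul := @nsmulRec N ⟨e⟩ ⟨add⟩
            zsmul := @zsmulRec N ⟨e⟩ ⟨add⟩ ⟨neg⟩ (@nsmulRec N ⟨e⟩ ⟨add⟩) }, ?_⟩
  refine Structure.ext ?_ ?_
  · funext n f x
    match n, f with
    | 2, PureGroupFunc.add =>
      refine congrArg (@Structure.funMap pureGroupLanguage N S 2 PureGroupFunc.add)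
        (funext fun i => ?_)
      fin_cases i <;> rfl
  · funext n r
    exact r.elim

/-! ### Elimination of quantifiers down to pp formulas -/

/-- The subgroups defined by positive primitive formulas. -/
def ppSubgroups (α : Type u) (n : ℕ) (M : Type v) [AddCommGroup M] :
    Set (AddSubgroup ((α → M) × (Fin n → M))) :=
  {K | ∃ (φ : pureGroupLanguage.BoundedFormula α n) (h : IsPP φ), h.subgroup M = K}

/-- Extending a tuple by one more entry. -/
def snocHom (α : Type u) (n : ℕ) (M : Type v) [AddCommGroup M] :
    ((α → M) × (Fin n → M)) × M →+ (α → M) × (Fin (n + 1) → M) :=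
  AddMonoidHom.mk' (fun p => (p.1.1, Fin.snoc (α := fun _ => M) p.1.2 p.2)) fun p q =>
    Prod.ext rfl (funext fun i => by refine Fin.lastCases ?_ (fun j => ?_) i <;> simp)

theorem cosetFamily_mono {M : Type u} [AddCommGroup M] {P Q : Set (AddSubgroup M)} (h : P ⊆ Q) :
    cosetFamily P ⊆ cosetFamily Q :=
  fun _ ⟨K, hK, hX⟩ => ⟨K, h hK, hX⟩

theorem preimage_mem_closure_cosetFamily {M : Type u} [AddCommGroup M] {N : Type v}
    [AddCommGroup N] {P : Set (AddSubgroup M)} {s : Set M}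
    (hs : s ∈ BooleanSubalgebra.closure (cosetFamily P)) (f : N →+ M) (c : M) :
    {x | c + f x ∈ s} ∈ BooleanSubalgebra.closure (cosetFamily (AddSubgroup.comap f '' P)) := by
  induction hs using BooleanSubalgebra.closure_bot_sup_induction with
  | mem s hs =>
    obtain ⟨K, hK, hKs⟩ := hs
    exact BooleanSubalgebra.subset_closure ⟨_, ⟨K, hK, rfl⟩, hKs.preimage f c⟩
  | bot => exact BooleanSubalgebra.bot_mem
  | sup s hs t ht h h' => exact BooleanSubalgebra.supClosed _ h h'
  | compl s hs h => exact BooleanSubalgebra.compl_mem h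

/-- Every formula is equivalent to a boolean combination of cosets of positive primitive
subgroups, in a fixed abelian group. -/
theorem setOf_realize_mem_closure {M : Type v} [AddCommGroup M] {α : Type u} {n : ℕ}
    (φ : pureGroupLanguage.BoundedFormula α n) :
    {p : (α → M) × (Fin n → M) | φ.Realize p.1 p.2} ∈
      BooleanSubalgebra.closure (cosetFamily (ppSubgroups α n M)) := by
  induction φ with
  | falsum => exact BooleanSubalgebra.bot_mem
  | equal t t' =>
    refine BooleanSubalgebra.subset_closure ⟨_, ⟨_, .equal t t', rfl⟩, fun x hx y => ?_⟩
    have hx' : x ∈ (IsPP.equal t t').subgroup M := hx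
    refine ⟨fun hy => sub_mem hy hx', fun h => ?_⟩
    have hy := add_mem h hx'
    rwa [sub_add_cancel] at hy
  | rel R => exact R.elim
  | imp φ ψ h h' =>
    have hset : {p : (α → M) × (Fin _ → M) | (φ.imp ψ).Realize p.1 p.2} =
        {p | φ.Realize p.1 p.2}ᶜ ⊔ {p | ψ.Realize p.1 p.2} := by
      ext p
      exact (BoundedFormula.realize_imp).trans imp_iff_not_or
    rw [hset]
    exact BooleanSubalgebra.supClosed _ (BooleanSubalgebra.compl_mem h) h'
  | @all n φ h =>
    -- `∀` is the complement of the projection of the complement, and projecting a pp subgroup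
    -- amounts to an existential quantifier.
    have h1 := preimage_mem_closure_cosetFamily (BooleanSubalgebra.compl_mem h) (snocHom α n M) 0
    have h2 := image_fst_mem_closure_cosetFamily (P := AddSubgroup.comap (snocHom α n M) ''
      ppSubgroups α (n + 1) M) ?_ ?_ h1
    · have h3 : AddSubgroup.map (AddMonoidHom.fst _ M) '' (AddSubgroup.comap (snocHom α n M) ''
          ppSubgroups α (n + 1) M) ⊆ ppSubgroups α n M := by
        rintro _ ⟨_, ⟨_, ⟨ψ, hψ, rfl⟩, rfl⟩, rfl⟩
        refine ⟨ψ.ex, hψ.ex, ?_⟩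
        ext p
        rw [IsPP.mem_subgroup, BoundedFormula.realize_ex, AddSubgroup.mem_map]
        constructor
        · rintro ⟨a, ha⟩
          exact ⟨(p, a), ha, rfl⟩
        · rintro ⟨⟨p, a⟩, ha, rfl⟩
          exact ⟨a, ha⟩
      have h4 := BooleanSubalgebra.closure_mono (cosetFamily_mono h3) h2
      have hset : {p : (α → M) × (Fin n → M) | φ.all.Realize p.1 p.2} = (Prod.fst '' {x | 0 +
          snocHom α n M x ∈ {p : (α → M) × (Fin (n + 1) → M) | φ.Realize p.1 p.2}ᶜ})ᶜ := by
        ext p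
        simp only [Set.mem_ofPred_eq, BoundedFormula.realize_all, Set.mem_compl_iff, Set.mem_image,
          not_exists, not_and, zero_add]
        constructor
        · rintro hp ⟨q, a⟩ hqa rfl
          exact hqa (hp a)
        · intro hp a
          by_contra hc
          exact hp (p, a) hc rfl
      rw [hset]
      exact BooleanSubalgebra.compl_mem h4
    · let t : pureGroupLanguage.Term (α ⊕ Fin (n + 1)) := Term.var (Sum.inr (Fin.last n))
      refine ⟨_, ⟨_, .equal t t, rfl⟩, ?_⟩
      rw [eq_top_iff]
      intro p _
      exact BoundedFormula.realize_bdEqual t t |>.2 rfl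
    · rintro _ ⟨_, ⟨ψ, hψ, rfl⟩, rfl⟩ _ ⟨_, ⟨χ, hχ, rfl⟩, rfl⟩
      refine ⟨_, ⟨_, hψ.inf hχ, rfl⟩, ?_⟩
      rw [← AddSubgroup.comap_inf]
      congr 1
      ext p
      exact BoundedFormula.realize_inf

/-- Every definable set is a boolean combination of cosets of positive primitive subgroups. -/
theorem definable_mem_closure {M : Type u} [AddCommGroup M] {s : Set M}
    (hs : Set.Definable₁ (Set.univ : Set M) pureGroupLanguage s) :
    s ∈ BooleanSubalgebra.closure (cosetFamily (Set.range fun φ : UnaryPP => φ.subgroup M)) := by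
  obtain ⟨φ, hφ⟩ := Set.definable_iff_exists_formula_sum.1 hs
  let α := (Set.univ : Set M) ⊕ Fin 1
  let f : M →+ (α → M) × (Fin 0 → M) :=
    AddMonoidHom.mk' (fun x => (Sum.elim (fun _ => 0) fun _ => x, 0)) fun x y =>
      Prod.ext (funext fun i => by rcases i with i | i <;> simp) (by simp)
  let c : (α → M) × (Fin 0 → M) := (Sum.elim (fun a => a) fun _ => 0, 0)
  have h := preimage_mem_closure_cosetFamily (setOf_realize_mem_closure (M := M) φ) f c
  have hset : s = {x | c + f x ∈ {p : (α → M) × (Fin 0 → M) | BoundedFormula.Realize φ p.1 p.2}} := by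
    ext x
    have hx := Set.ext_iff.1 hφ fun _ => x
    refine Iff.trans hx (iff_of_eq (congr_arg₂ (BoundedFormula.Realize φ) (funext fun i => ?_)
      (Subsingleton.elim _ _)))
    rcases i with i | i <;> simp [c, f]
  rw [hset]
  refine BooleanSubalgebra.closure_mono (cosetFamily_mono ?_) h
  rintro _ ⟨_, ⟨ψ, hψ, rfl⟩, rfl⟩
  -- Parameters only translate cosets, so in the subgroup they all become `0`, the value of the
  -- variable `false`.
  refine ⟨⟨ψ.subst (Sum.elim (fun _ => Term.var false) fun _ => Term.var true), hψ.subst _⟩, ?_⟩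
  ext x
  simp only [UnaryPP.mem_subgroup]
  rw [Formula.Realize, BoundedFormula.realize_subst, AddSubgroup.mem_comap, IsPP.mem_subgroup]
  refine iff_of_eq (congr_arg₂ (BoundedFormula.Realize ψ) (funext fun i => ?_)
      (Subsingleton.elim _ _))
  rcases i with i | i <;> rfl

/-! ### VC-minimality as a condition on indices -/

/-- The condition on positive primitive subgroups that characterizes VC-minimality. -/
def BoundedPP (A : Type u) [AddCommGroup A] : Prop :=
  ∀ φ : UnaryPP, ∃ N, ∀ ψ : UnaryPP, (φ.subgroup A).relIndex (ψ.subgroup A) ≠ 0 ∨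
    (ψ.subgroup A).relIndex (φ.subgroup A) ≠ 0 ∧ (ψ.subgroup A).relIndex (φ.subgroup A) ≤ N

/-- The number `k` of instances needed for cosets of `φ` depends on `φ` alone, so it serves as the
bound for all `ψ`. -/
theorem BoundedPP.of_vcMinimal {A : Type u} [AddCommGroup A]
    (h : VCMinimal.{0, 0, w} (groupTheory A)) : BoundedPP A := by
  obtain ⟨Ψ, hdir, hgen⟩ := h
  intro φ
  obtain ⟨k, hk⟩ := exists_card_bound hgen φ.cosetFormula
  refine ⟨k, fun ψ => or_iff_not_imp_left.2 fun h0 => ?_⟩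
  rw [not_not] at h0
  have key : ∀ (M : Type w) [AddCommGroup M] [M ⊨ groupTheory A],
      (ψ.subgroup A).relIndex (φ.subgroup A) ≠ 0 ∧
        (ψ.subgroup A).relIndex (φ.subgroup A) ≤ k := by
    intro M _ _
    rw [← relIndex_subgroup_eq (A := A) (N := M) ψ φ]
    refine (hdir ⟨M⟩).relIndex_le (φ.subgroup M) (ψ.subgroup M) k (fun a => ?_) (fun a => ?_)
      ((relIndex_subgroup_eq φ ψ).trans h0)
    · rw [← φ.instanceSet_eq]
      exact hk ⟨M⟩ ![-a, 0]
    · rw [← ψ.instanceSet_eq]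
      exact exists_separatedBy_of_mem_closure
        (hgen ⟨M⟩ _ (ψ.cosetFormula.definable_instanceSet ![-a, 0]))
  have key' : ∀ (M : Type w) [pureGroupLanguage.Structure M] [M ⊨ groupTheory A] [Nonempty M],
      (ψ.subgroup A).relIndex (φ.subgroup A) ≠ 0 ∧
        (ψ.subgroup A).relIndex (φ.subgroup A) ≤ k := by
    intro M _ _ _
    obtain ⟨G, rfl⟩ := exists_addCommGroup_of_model A M
    exact key M
  have : A ⊨ groupTheory A := inferInstanceAs (A ⊨ pureGroupLanguage.completeTheory A)
  obtain ⟨M⟩ : (groupTheory A).IsSatisfiable := Theory.Model.isSatisfiable A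
  -- `A` may live in another universe; any model in `Type w` has the same indices.
  exact key' (Theory.ModelType.ulift.{0, 0, 0, w} M)

theorem IsCosetOrEmpty.mem_closure_of_relIndex_ne_zero {M : Type u} [AddCommGroup M]
    {H K : AddSubgroup M} (hfin : K.relIndex H ≠ 0) (hle : K ≤ H) {X : Set M}
    (hX : IsCosetOrEmpty H X) {F : Set (Set M)} (hF : ∀ a, {x | x - a ∈ K} ∈ F) :
    X ∈ BooleanSubalgebra.closure F := by
  rcases X.eq_empty_or_nonempty with rfl | ⟨x₀, hx₀⟩
  · exact BooleanSubalgebra.bot_mem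
  have : Finite (H ⧸ K.addSubgroupOf H) := Nat.finite_of_card_ne_zero hfin
  have : X = ⨆ q : H ⧸ K.addSubgroupOf H, {x | x - (x₀ + (q.out : M)) ∈ K} := by
    ext x
    simp only [Set.iSup_eq_iUnion, Set.mem_iUnion, Set.mem_ofPred_eq]
    rw [hX x₀ hx₀]
    constructor
    · intro hx
      refine ⟨((⟨x - x₀, hx⟩ : H) : H ⧸ K.addSubgroupOf H), ?_⟩
      have := QuotientAddGroup.eq.1
        (QuotientAddGroup.out_eq' ((⟨x - x₀, hx⟩ : H) : H ⧸ K.addSubgroupOf H))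
      rw [AddSubgroup.mem_addSubgroupOf] at this
      convert this using 1
      simp only [AddSubgroup.coe_add, AddSubgroup.coe_neg]
      abel
    · rintro ⟨q, hq⟩
      have := H.add_mem (hle hq) q.out.2
      convert this using 1
      abel
  rw [this]
  exact BooleanSubalgebra.iSup_mem fun q => BooleanSubalgebra.subset_closure (hF _)

/-- The directed set consists of the coset formulas whose subgroup in `A` lies in the chain.
Inclusion means index 1, so the chain and its finite indices persist in every model. -/
theorem BoundedPP.vcMinimal {A : Type u} [AddCommGroup A] (h : BoundedPP A) :
    VCMinimal.{0, 0, w} (groupTheory A) := by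
  have : Countable UnaryPP := by
    have : Countable pureGroupLanguage.Symbols := by
      have : ∀ n, Countable (pureGroupLanguage.Functions n) := fun n =>
        (show Function.Injective fun _ : PureGroupFunc n => () from
          fun a b _ => by cases a; cases b; rfl).countable
      have : ∀ n, Countable (pureGroupLanguage.Relations n) := fun n =>
        inferInstanceAs (Countable Empty)
      exact inferInstanceAs (Countable ((Σ n, pureGroupLanguage.Functions n) ⊕
        Σ n, pureGroupLanguage.Relations n))
    have : Function.Injective fun φ : UnaryPP =>
        (⟨0, φ.1⟩ : Σ n, pureGroupLanguage.BoundedFormula Bool n) := by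
      intro φ ψ hφψ
      simpa [Subtype.ext_iff] using hφψ
    exact this.countable
  obtain ⟨F, hFP, hchain, hfin⟩ := exists_chain_of_relIndex_bounded
    (P := Set.range fun φ : UnaryPP => φ.subgroup A) (Set.countable_range _)
    (by
      rintro _ ⟨φ, rfl⟩ _ ⟨ψ, rfl⟩
      exact ⟨φ.inf ψ, φ.subgroup_inf ψ A⟩)
    (by
      rintro _ ⟨φ, rfl⟩
      obtain ⟨N, hN⟩ := h φ
      refine ⟨N, ?_⟩
      rintro _ ⟨ψ, rfl⟩
      exact hN ψ)
  have key : ∀ (M : Type w) [G : AddCommGroup M] [M ⊨ groupTheory A],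
      DirectedFamily (instanceFamily (UnaryPP.cosetFormula '' {φ | φ.subgroup A ∈ F}) M) ∧
      ∀ s : Set M, Set.Definable₁ (Set.univ : Set M) pureGroupLanguage s →
        s ∈ BooleanSubalgebra.closure
          (instanceFamily (UnaryPP.cosetFormula '' {φ | φ.subgroup A ∈ F}) M) := by
    intro M _ _
    have hle : ∀ φ ψ : UnaryPP, φ.subgroup A ≤ ψ.subgroup A → φ.subgroup M ≤ ψ.subgroup M := by
      intro φ ψ hφψ
      rw [← AddSubgroup.relIndex_eq_one] at hφψ ⊢
      rwa [relIndex_subgroup_eq (A := A)]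
    constructor
    · rintro _ ⟨_, ⟨φ, hφ, rfl⟩, a, rfl⟩ _ ⟨_, ⟨ψ, hψ, rfl⟩, b, rfl⟩
      have hφc := φ.isCosetOrEmpty_instanceSet a
      have hψc := ψ.isCosetOrEmpty_instanceSet b
      rcases (φ.cosetFormula.instanceSet a ∩ ψ.cosetFormula.instanceSet b).eq_empty_or_nonempty with
        hem | ⟨x, hx, hx'⟩
      · exact Or.inr (Or.inr hem)
      rcases hchain.total hφ hψ with hφψ | hφψ
      · exact Or.inl fun y hy => (hψc x hx' y).2 (hle φ ψ hφψ ((hφc x hx y).1 hy))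
      · exact Or.inr (Or.inl fun y hy => (hφc x hx y).2 (hle ψ φ hφψ ((hψc x hx' y).1 hy)))
    · intro s hs
      refine BooleanSubalgebra.closure_le.2 ?_ (definable_mem_closure hs)
      rintro X ⟨_, ⟨φ, rfl⟩, hX⟩
      obtain ⟨_, hK, hKle, hKfin⟩ := hfin _ ⟨φ, rfl⟩
      obtain ⟨ψ, rfl⟩ := hFP hK
      refine hX.mem_closure_of_relIndex_ne_zero (K := ψ.subgroup M) ?_ (hle ψ φ hKle) fun a => ?_
      · rwa [relIndex_subgroup_eq (A := A)]
      · exact ⟨_, ⟨ψ, hK, rfl⟩, ![-a, 0], (ψ.instanceSet_eq a).symm⟩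
  have key' : ∀ (M : Type w) [S : pureGroupLanguage.Structure M] [M ⊨ groupTheory A] [Nonempty M],
      DirectedFamily (instanceFamily (UnaryPP.cosetFormula '' {φ | φ.subgroup A ∈ F}) M) ∧
      ∀ s : Set M, Set.Definable₁ (Set.univ : Set M) pureGroupLanguage s →
        s ∈ BooleanSubalgebra.closure
          (instanceFamily (UnaryPP.cosetFormula '' {φ | φ.subgroup A ∈ F}) M) := by
    intro M S _ _
    obtain ⟨G, rfl⟩ := exists_addCommGroup_of_model A M
    exact key M
  exact ⟨_, fun M => (key' M).1, fun M => (key' M).2⟩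

/-! ### Direct products -/

theorem AddSubgroup.relIndex_prod {A : Type u} [AddCommGroup A] {B : Type v} [AddCommGroup B]
    (H H' : AddSubgroup A) (K K' : AddSubgroup B) :
    (H.prod K).relIndex (H'.prod K') = H.relIndex H' * K.relIndex K' := by
  let e : H'.prod K' ≃+ H' × K' := AddSubgroup.prodEquiv H' K'
  have : (H.prod K).addSubgroupOf (H'.prod K') =
      ((H.addSubgroupOf H').prod (K.addSubgroupOf K')).comap e.toAddMonoidHom := by
    ext x
    rfl
  rw [AddSubgroup.relIndex, this, AddSubgroup.index_comap_of_surjective _ e.surjective,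
    AddSubgroup.index_prod]
  rfl

/-- A nonzero product of indices has nonzero factors, each at most the product, so the bound for `A
× B` works for `A`. -/
theorem BoundedPP.fst {A : Type u} [AddCommGroup A] {B : Type v} [AddCommGroup B]
    (h : BoundedPP (A × B)) : BoundedPP A := by
  intro φ
  obtain ⟨N, hN⟩ := h φ
  refine ⟨N, fun ψ => ?_⟩
  have := hN ψ
  simp only [UnaryPP.subgroup_prod, AddSubgroup.relIndex_prod] at this
  refine this.imp left_ne_zero_of_mul fun ⟨h1, h2⟩ => ⟨left_ne_zero_of_mul h1, ?_⟩
  exact (Nat.le_mul_of_pos_right _ (Nat.pos_of_ne_zero (right_ne_zero_of_mul h1))).trans h2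

/-- Indices in `B` are nonzero and at most `|B|`, so finiteness is unaffected and bounds grow by the
factor `|B|`. -/
theorem BoundedPP.prod_of_finite {A : Type u} [AddCommGroup A] {B : Type v} [AddCommGroup B]
    [Finite B] (h : BoundedPP A) : BoundedPP (A × B) := by
  have hB : ∀ H K : AddSubgroup B, H.relIndex K ≠ 0 ∧ H.relIndex K ≤ Nat.card B := fun H K =>
    ⟨Nat.card_pos.ne', (Nat.card_le_card_of_surjective (QuotientAddGroup.mk' _)
      (QuotientAddGroup.mk'_surjective _)).trans (Nat.card_le_card_of_injective _
        K.subtype_injective)⟩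
  intro φ
  obtain ⟨N, hN⟩ := h φ
  refine ⟨N * Nat.card B, fun ψ => ?_⟩
  simp only [UnaryPP.subgroup_prod, AddSubgroup.relIndex_prod]
  exact (hN ψ).imp (fun h => mul_ne_zero h (hB _ _).1) fun h =>
    ⟨mul_ne_zero h.1 (hB _ _).1, Nat.mul_le_mul h.2 (hB _ _).2⟩

theorem vcMinimal_groupTheory_iff {A : Type u} [AddCommGroup A] :
    VCMinimal.{0, 0, w} (groupTheory A) ↔ BoundedPP A :=
  ⟨BoundedPP.of_vcMinimal, BoundedPP.vcMinimal⟩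

end PurePP

theorem lemma5 (A : Type u) [AddCommGroup A] (B : Type v) [AddCommGroup B] :
    (VCMinimal.{0, 0, w} (groupTheory (A × B)) → VCMinimal.{0, 0, w} (groupTheory A)) ∧
    (Finite B →
      (VCMinimal.{0, 0, w} (groupTheory A) ↔ VCMinimal.{0, 0, w} (groupTheory (A × B)))) := by
  simp only [vcMinimal_groupTheory_iff]
  exact ⟨BoundedPP.fst, fun _ => ⟨BoundedPP.prod_of_finite, BoundedPP.fst⟩⟩
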